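/- Let $\mathcal{E}$ be an exact category in the sense of Quillen, $\mathcal{M}\subseteq\mathcal{E}$ a full additive subcategory and $k\ge 1$ an integer. Write $\mathcal{M}\text{-}\mathrm{Mod}$ (resp. $\mathrm{Mod}\text{-}\mathcal{M}$) for the abelian category of covariant (resp. contravariant) additive functors from $\mathcal{M}$ to abelian groups, and $\Psi(Z)=\mathrm{Hom}_{\mathcal{E}}(Z,-)|_{\mathcal{M}}\in\mathcal{M}\text{-}\mathrm{Mod}$, $\Phi(Z)=\mathrm{Hom}_{\mathcal{E}}(-,Z)|_{\mathcal{M}}\in\mathrm{Mod}\text{-}\mathcal{M}$. Let $\mathrm{Ext}^i_{\mathcal{E}}(Y,X)$ be the Yoneda extension groups of $\mathcal{E}$ (classes of exact sequences $0\to X\to E_i\to\cdots\to E_1\to Y\to 0$, and $\mathrm{Hom}_{\mathcal{E}}(Y,X)$ for $i=0$). Let $\mathrm{cogen}^k_{\mathcal{E}}(\mathcal{M})$ be the full subcategory of the objects $X$ for which there is an exact sequence $0\to X\to M_0\to\cdots\to M_k\to Z\to 0$ in $\mathcal{E}$ with all $M_j\in\mathcal{M}$ such that $\mathrm{Hom}(M_k,M)\to\cdots\to\mathrm{Hom}(M_0,M)\to\mathrm{Hom}(X,M)\to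 0$ is exact for every $M\in\mathcal{M}$. Let $\mathrm{gen}_k^{\mathcal{E}}(\mathcal{M})$ be the full subcategory of the objects $Y$ for which there is an exact sequence $0\to Z\to M_k\to\cdots\to M_0\to Y\to 0$ in $\mathcal{E}$ with all $M_j\in\mathcal{M}$ such that $\mathrm{Hom}(M,M_k)\to\cdots\to\mathrm{Hom}(M,M_0)\to\mathrm{Hom}(M,Y)\to 0$ is exact for every $M\in\mathcal{M}$. (a) For $X\in\mathrm{cogen}^k_{\mathcal{E}}(\mathcal{M})$, all $Y$ with $\mathrm{Ext}^i_{\mathcal{E}}(Y,M)=0$ for all $M\in\mathcal{M}$ and $1\le i<k$, and $0\le i<k$, the functor $\Psi$ induces a well-defined isomorphism of abelian groups $$\mathrm{Ext}^i_{\mathcal{E}}(Y,X)\to\mathrm{Ext}^i_{\mathcal{M}\text{-}\mathrm{Mod}}(\Psi(X),\Psi(Y)),$$ natural in such $X$ and $Y$. (b) For $Y\in\mathrm{gen}_k^{\mathcal{E}}(\mathcal{M})$, all $X$ with $\mathrm{Ext}^i_{\mathcal{E}}(M,X)=0$ for all $M\in\mathcal{M}$ and $1\le i<k$, and $0\le i<k$,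 the functor $\Phi$ induces a well-defined isomorphism of abelian groups $$\mathrm{Ext}^i_{\mathcal{E}}(Y,X)\to\mathrm{Ext}^i_{\mathrm{Mod}\text{-}\mathcal{M}}(\Phi(Y),\Phi(X)),$$ natural in such $X$ and $Y$. Here "induces a well-defined isomorphism" means: every class in $\mathrm{Ext}^i_{\mathcal{E}}(Y,X)$ is represented by an $i$-fold extension (a morphism if $i=0$) whose image under $\Psi$ (resp. $\Phi$) is exact, and the isomorphism sends the class to the class of the image of any such representative. -/

import Mathlib

open CategoryTheory CategoryTheory.Limits
universe w v u v' u'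

namespace AddModule
section
variable {A : Type u} [Category.{v} A] [Preadditive A]

instance isClosedUnderLimitsOfShape (J : Type) [SmallCategory J] :
    (additiveFunctor A AddCommGrpCat.{v}).IsClosedUnderLimitsOfShape J where
  limitsOfShape_le := by
    rintro F ⟨h⟩
    refine ⟨fun {X Y f g} => ?_⟩
    have hl := isLimitOfPreserves ((evaluation A AddCommGrpCat.{v}).obj Y) h.isLimit
    refine hl.hom_ext fun j => ?_
    have hj : (h.diag.obj j).Additive := h.prop_diag_obj j
    change F.map (f + g) ≫ (h.π.app j).app Y = (F.map f + F.map g) ≫ (h.π.app j).app Y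
    rw [Preadditive.add_comp]
    have e := fun t : X ⟶ Y => (h.π.app j).naturality t
    dsimp at e
    rw [e, e, e, (h.diag.obj j).map_add, Preadditive.comp_add]

instance isClosedUnderColimitsOfShape (J : Type) [SmallCategory J] :
    (additiveFunctor A AddCommGrpCat.{v}).IsClosedUnderColimitsOfShape J where
  colimitsOfShape_le := by
    rintro F ⟨h⟩
    refine ⟨fun {X Y f g} => ?_⟩
    have hl := isColimitOfPreserves ((evaluation A AddCommGrpCat.{v}).obj X) h.isColimit
    refine hl.hom_ext fun j => ?_
    have hj : (h.diag.obj j).Additive := h.prop_diag_obj j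
    change (h.ι.app j).app X ≫ F.map (f + g) = (h.ι.app j).app X ≫ (F.map f + F.map g)
    rw [Preadditive.comp_add]
    have e := fun t : X ⟶ Y => (h.ι.app j).naturality t
    dsimp at e
    rw [← e, ← e, ← e, (h.diag.obj j).map_add, Preadditive.add_comp]

instance : (additiveFunctor A AddCommGrpCat.{v}).IsClosedUnderKernels where
  kernels_le := by
    rintro _ ⟨f, k, hk, hf⟩
    refine ObjectProperty.prop_of_isLimit _ hk ?_
    rintro (_ | _)
    exacts [hf.1, hf.2]

instance : (additiveFunctor A AddCommGrpCat.{v}).IsClosedUnderCokernels where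
  cokernels_le := by
    rintro _ ⟨f, k, hk, hf⟩
    refine ObjectProperty.prop_of_isColimit _ hk ?_
    rintro (_ | _)
    exacts [hf.1, hf.2]

instance : (additiveFunctor A AddCommGrpCat.{v}).IsClosedUnderFiniteProducts where

instance : (additiveFunctor A AddCommGrpCat.{v}).ContainsZero where
  exists_zero := by
    refine ⟨_, isZero_zero (A ⥤ AddCommGrpCat.{v}), ⟨fun {X Y f g} => ?_⟩⟩
    exact ((isZero_zero (A ⥤ AddCommGrpCat.{v})).obj X).eq_of_src _ _

/-- The category of additive functors from `A` to abelian groups is abelian, with the structure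
induced by that of all functors. -/
noncomputable instance : Abelian (A ⥤+ AddCommGrpCat.{v}) := inferInstance

instance : HasExt.{max u (v+1)} (A ⥤+ AddCommGrpCat.{v}) := HasExt.standard _
end
end AddModule

section Exact
variable {C : Type u} [Category.{v} C] [Preadditive C]

/-- A morphism is an inflation if it is the first morphism of a distinguished short complex. -/
def IsInflationFor (K : ObjectProperty (ShortComplex C)) {A B : C} (i : A ⟶ B) : Prop :=
  ∃ (Z : C) (p : B ⟶ Z) (w : i ≫ p = 0), K (ShortComplex.mk i p w)

/-- A morphism is a deflation if it is the second morphism of a distinguished short complex. -/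
def IsDeflationFor (K : ObjectProperty (ShortComplex C)) {B Z : C} (p : B ⟶ Z) : Prop :=
  ∃ (A : C) (i : A ⟶ B) (w : i ≫ p = 0), K (ShortComplex.mk i p w)

variable (C) in
/-- An exact structure in the sense of Quillen on an additive category: a class of kernel-cokernel
pairs, called conflations. -/
structure ExactStructure where
  /-- the conflations `A ⟶ B ⟶ Z` -/
  conflation : ObjectProperty (ShortComplex C)
  conflation_of_iso : ∀ {S T : ShortComplex C}, (S ≅ T) → conflation S → conflation T
  isKernel : ∀ S : ShortComplex C, conflation S → Nonempty (IsLimit (KernelFork.ofι S.f S.zero))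
  isCokernel : ∀ S : ShortComplex C, conflation S →
    Nonempty (IsColimit (CokernelCofork.ofπ S.g S.zero))
  inflation_id : ∀ A : C, IsInflationFor conflation (𝟙 A)
  deflation_id : ∀ A : C, IsDeflationFor conflation (𝟙 A)
  inflation_comp : ∀ {A B D : C} (i : A ⟶ B) (j : B ⟶ D),
    IsInflationFor conflation i → IsInflationFor conflation j → IsInflationFor conflation (i ≫ j)
  deflation_comp : ∀ {A B D : C} (p : A ⟶ B) (q : B ⟶ D),
    IsDeflationFor conflation p → IsDeflationFor conflation q → IsDeflationFor conflation (p ≫ q)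
  /-- the push-out of an inflation along any morphism exists and is an inflation -/
  inflation_pushout : ∀ {A B A' : C} (i : A ⟶ B) (f : A ⟶ A'), IsInflationFor conflation i →
    ∃ (B' : C) (f' : B ⟶ B') (i' : A' ⟶ B'), IsPushout i f f' i' ∧ IsInflationFor conflation i'
  /-- the pull-back of a deflation along any morphism exists and is a deflation -/
  deflation_pullback : ∀ {B Z Z' : C} (p : B ⟶ Z) (f : Z' ⟶ Z), IsDeflationFor conflation p →
    ∃ (B' : C) (f' : B' ⟶ B) (p' : B' ⟶ Z'), IsPullback f' p' p f ∧ IsDeflationFor conflation p'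

namespace ExactStructure

variable (𝓔 : ExactStructure C)

/-- `A ⟶ B ⟶ Z` is a conflation. -/
def IsConflation {A B Z : C} (i : A ⟶ B) (p : B ⟶ Z) : Prop :=
  ∃ w : i ≫ p = 0, 𝓔.conflation (ShortComplex.mk i p w)

variable {𝓔}

namespace IsConflation

variable {A B Z : C} {i : A ⟶ B} {p : B ⟶ Z}

lemma zero (h : 𝓔.IsConflation i p) : i ≫ p = 0 := h.1

lemma mono (h : 𝓔.IsConflation i p) : Mono i := by
  obtain ⟨hl⟩ := 𝓔.isKernel _ h.2
  exact mono_of_isLimit_fork hl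

lemma epi (h : 𝓔.IsConflation i p) : Epi p := by
  obtain ⟨hl⟩ := 𝓔.isCokernel _ h.2
  exact epi_of_isColimit_cofork hl

lemma exists_lift (h : 𝓔.IsConflation i p) {T : C} (f : T ⟶ B) (hf : f ≫ p = 0) :
    ∃ g : T ⟶ A, g ≫ i = f := by
  obtain ⟨hl⟩ := 𝓔.isKernel _ h.2
  exact ⟨hl.lift (KernelFork.ofι f hf), hl.fac _ WalkingParallelPair.zero⟩

lemma exists_desc (h : 𝓔.IsConflation i p) {T : C} (f : B ⟶ T) (hf : i ≫ f = 0) :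
    ∃ g : Z ⟶ T, p ≫ g = f := by
  obtain ⟨hl⟩ := 𝓔.isCokernel _ h.2
  exact ⟨hl.desc (CokernelCofork.ofπ f hf), hl.fac _ WalkingParallelPair.one⟩

lemma of_iso (h : 𝓔.IsConflation i p) {A' B' Z' : C} {i' : A' ⟶ B'} {p' : B' ⟶ Z'}
    (e₁ : A ≅ A') (e₂ : B ≅ B') (e₃ : Z ≅ Z') (h₁ : i ≫ e₂.hom = e₁.hom ≫ i')
    (h₂ : p ≫ e₃.hom = e₂.hom ≫ p') : 𝓔.IsConflation i' p' := by
  have w : i' ≫ p' = 0 := by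
    rw [← cancel_epi e₁.hom, ← reassoc_of% h₁, ← h₂, reassoc_of% h.zero, zero_comp, comp_zero]
  exact ⟨w, 𝓔.conflation_of_iso (S := ShortComplex.mk i p h.zero) (T := ShortComplex.mk i' p' w)
    (ShortComplex.isoMk e₁ e₂ e₃ h₁.symm h₂.symm) h.2⟩

/-- An inflation and any cokernel of it form a conflation. -/
lemma of_cokernel {B' Z' : C} {j : A ⟶ B'} {q : B' ⟶ Z'} (hj : IsInflationFor 𝓔.conflation j)
    (w : j ≫ q = 0) (hq : Epi q)
    (hd : ∀ {T : C} (f : B' ⟶ T), j ≫ f = 0 → ∃ g : Z' ⟶ T, q ≫ g = f) :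
    𝓔.IsConflation j q := by
  obtain ⟨Z₀, q₀, w₀, h₀⟩ := hj
  have H : 𝓔.IsConflation j q₀ := ⟨w₀, h₀⟩
  have := H.epi
  obtain ⟨a, ha⟩ := hd q₀ w₀
  obtain ⟨b, hb⟩ := H.exists_desc q w
  let e : Z₀ ≅ Z' := ⟨b, a, by rw [← cancel_epi q₀, reassoc_of% hb, ha, Category.comp_id],
    by rw [← cancel_epi q, reassoc_of% ha, hb, Category.comp_id]⟩
  exact H.of_iso (Iso.refl _) (Iso.refl _) e (by simp) (by simp [e, hb])

/-- A deflation and any kernel of it form a conflation. -/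
lemma of_kernel {A' B' : C} {j : A' ⟶ B'} {q : B' ⟶ Z} (hq : IsDeflationFor 𝓔.conflation q)
    (w : j ≫ q = 0) (hj : Mono j)
    (hd : ∀ {T : C} (f : T ⟶ B'), f ≫ q = 0 → ∃ g : T ⟶ A', g ≫ j = f) :
    𝓔.IsConflation j q := by
  obtain ⟨A₀, j₀, w₀, h₀⟩ := hq
  have H : 𝓔.IsConflation j₀ q := ⟨w₀, h₀⟩
  have := H.mono
  obtain ⟨a, ha⟩ := hd j₀ w₀
  obtain ⟨b, hb⟩ := H.exists_lift j w
  let e : A₀ ≅ A' := ⟨a, b, by rw [← cancel_mono j₀, Category.assoc, hb, ha, Category.id_comp],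
    by rw [← cancel_mono j, Category.assoc, ha, hb, Category.id_comp]⟩
  exact H.of_iso e (Iso.refl _) (Iso.refl _) (by simp [e, ha]) (by simp)

lemma exists_pushout (h : 𝓔.IsConflation i p) {A' : C} (f : A ⟶ A') :
    ∃ (B' : C) (f' : B ⟶ B') (i' : A' ⟶ B') (p' : B' ⟶ Z),
      IsPushout i f f' i' ∧ 𝓔.IsConflation i' p' ∧ f' ≫ p' = p := by
  obtain ⟨B', f', i', sq, hi'⟩ := 𝓔.inflation_pushout i f ⟨_, p, h.1, h.2⟩
  refine ⟨B', f', i', sq.desc p 0 (by simp [h.zero]), sq, ?_, by simp⟩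
  have := h.epi
  refine of_cokernel hi' (by simp) ?_ ?_
  · have : Epi (f' ≫ sq.desc p 0 (by simp [h.zero])) := by simpa
    exact epi_of_epi f' _
  · intro T g hg
    obtain ⟨k, hk⟩ := h.exists_desc (f' ≫ g) (by rw [sq.w_assoc, hg, comp_zero])
    exact ⟨k, sq.hom_ext (by simp [hk]) (by simp [hg])⟩

lemma exists_pullback (h : 𝓔.IsConflation i p) {Z' : C} (f : Z' ⟶ Z) :
    ∃ (B' : C) (f' : B' ⟶ B) (i' : A ⟶ B') (p' : B' ⟶ Z'),
      IsPullback f' p' p f ∧ 𝓔.IsConflation i' p' ∧ i' ≫ f' = i := by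
  obtain ⟨B', f', p', sq, hp'⟩ := 𝓔.deflation_pullback p f ⟨_, i, h.1, h.2⟩
  refine ⟨B', f', sq.lift i 0 (by simp [h.zero]), p', sq, ?_, by simp⟩
  have := h.mono
  refine of_kernel hp' (by simp) ?_ ?_
  · have : Mono (sq.lift i 0 (by simp [h.zero]) ≫ f') := by simpa
    exact mono_of_mono _ f'
  · intro T g hg
    obtain ⟨k, hk⟩ := h.exists_lift (g ≫ f') (by rw [Category.assoc, sq.w, reassoc_of% hg, zero_comp])
    exact ⟨k, sq.hom_ext (by simp [hk]) (by simp [hg])⟩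

variable [HasBinaryBiproducts C]

lemma isPushout_biprod_map (i : A ⟶ B) (A' : C) :
    IsPushout i (biprod.inl : A ⟶ A ⊞ A') (biprod.inl : B ⟶ B ⊞ A') (biprod.map i (𝟙 A')) := by
  refine ⟨⟨by simp⟩, ⟨PushoutCocone.IsColimit.mk _
    (fun s => biprod.desc s.inl (biprod.inr ≫ s.inr)) (by simp) ?_ ?_⟩⟩
  · intro s
    ext
    · simpa using s.condition
    · simp
  · intro s m h₁ h₂
    ext
    · simpa using h₁
    · simp [← h₂]

lemma biprod_map (h : 𝓔.IsConflation i p) {A' B' Z' : C} {i' : A' ⟶ B'} {p' : B' ⟶ Z'}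
    (h' : 𝓔.IsConflation i' p') : 𝓔.IsConflation (biprod.map i i') (biprod.map p p') := by
  have key : ∀ {A B Z : C} {i : A ⟶ B} {p : B ⟶ Z} (_ : 𝓔.IsConflation i p) (D : C),
      IsInflationFor 𝓔.conflation (biprod.map i (𝟙 D)) := by
    intro A B Z i p h D
    obtain ⟨Q, f', j, q, sq, hj, _⟩ := h.exists_pushout (biprod.inl : A ⟶ A ⊞ D)
    let e := sq.isoIsPushout _ _ (isPushout_biprod_map i D)
    exact ⟨Z, e.inv ≫ q, hj.of_iso (Iso.refl _) e (Iso.refl _) (by simp [e]) (by simp)⟩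
  have h₁ : IsInflationFor 𝓔.conflation (biprod.map i (𝟙 A')) := key h A'
  have h₂ : IsInflationFor 𝓔.conflation (biprod.map (𝟙 B) i') := by
    obtain ⟨Z₀, q, w, hq⟩ := key h' B
    have hq' : 𝓔.IsConflation (biprod.map i' (𝟙 B)) q := ⟨w, hq⟩
    exact ⟨Z₀, (biprod.braiding B' B).inv ≫ q, hq'.of_iso (biprod.braiding _ _)
      (biprod.braiding _ _) (Iso.refl _) (by ext <;> simp) (by simp)⟩
  have h₃ := 𝓔.inflation_comp _ _ h₁ h₂
  have e : biprod.map i (𝟙 A') ≫ biprod.map (𝟙 B) i' = biprod.map i i' := by ext <;> simp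
  rw [e] at h₃
  have := h.epi
  have := h'.epi
  refine of_cokernel h₃ (by ext <;> simp [h.zero, h'.zero]) ?_ ?_
  · refine ⟨fun a b hab => ?_⟩
    have e₁ := biprod.inl ≫= hab
    have e₂ := biprod.inr ≫= hab
    simp only [biprod.inl_map_assoc, biprod.inr_map_assoc, cancel_epi] at e₁ e₂
    ext
    exacts [e₁, e₂]
  · intro T f hf
    obtain ⟨a, ha⟩ := h.exists_desc (biprod.inl ≫ f) (by simpa using biprod.inl ≫= hf)
    obtain ⟨b, hb⟩ := h'.exists_desc (biprod.inr ≫ f) (by simpa using biprod.inr ≫= hf)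
    exact ⟨biprod.desc a b, by ext <;> simp [ha, hb]⟩

end IsConflation

variable (𝓔) in
lemma isConflation_zero_id {O : C} (hO : IsZero O) (Y : C) :
    𝓔.IsConflation (0 : O ⟶ Y) (𝟙 Y) := by
  refine IsConflation.of_kernel (𝓔.deflation_id Y) (by simp) ⟨fun a b _ => hO.eq_of_tgt _ _⟩ ?_
  intro T f hf
  exact ⟨0, by simpa using hf.symm⟩

variable (𝓔) in
lemma isConflation_split [HasZeroObject C] [HasBinaryBiproducts C] (X Y : C) :
    𝓔.IsConflation (biprod.inl : X ⟶ X ⊞ Y) (biprod.snd : X ⊞ Y ⟶ Y) := by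
  have h := 𝓔.isConflation_zero_id (isZero_zero C) Y
  obtain ⟨B', f', i', p', sq, hc, hp⟩ := h.exists_pushout (0 : _ ⟶ X)
  refine IsConflation.of_cokernel ?_ (by simp) inferInstance ?_
  · let a : X ⊞ Y ⟶ B' := biprod.desc i' f'
    let b : B' ⟶ X ⊞ Y := sq.desc biprod.inr biprod.inl (by simp)
    let e : B' ≅ X ⊞ Y := ⟨b, a, by apply sq.hom_ext <;> simp [a, b],
      by ext <;> simp [a, b]⟩
    exact ⟨Y, e.inv ≫ p', hc.of_iso (Iso.refl _) e (Iso.refl _) (by simp [e, b]) (by simp)⟩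
  · intro T f hf
    exact ⟨biprod.inr ≫ f, by ext <;> simp [hf]⟩

variable (𝓔)

/-- An `n`-fold Yoneda extension of `Y` by `X`: for `n = 0` a morphism `Y ⟶ X`, and for `n ≥ 1` an
exact sequence `0 ⟶ X ⟶ Eₙ ⟶ ⋯ ⟶ E₁ ⟶ Y ⟶ 0`, that is, `n` conflations
`X ⟶ Eₙ ⟶ Zₙ₋₁`, ..., `Z₁ ⟶ E₁ ⟶ Y` spliced together. -/
inductive YonedaExtension (X : C) : ℕ → C → Type (max u v)
  | hom {Y : C} (f : Y ⟶ X) : YonedaExtension X 0 Y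
  | single {E Y : C} (i : X ⟶ E) (p : E ⟶ Y) (h : 𝓔.IsConflation i p) : YonedaExtension X 1 Y
  | splice {n : ℕ} {Z E Y : C} (i : Z ⟶ E) (p : E ⟶ Y) (h : 𝓔.IsConflation i p)
      (ξ : YonedaExtension X (n + 1) Z) : YonedaExtension X (n + 2) Y

variable {𝓔}

namespace YonedaExtension

/-- There is a morphism of `n`-fold extensions, i.e. a commutative diagram
```
0 ⟶ X  ⟶ Eₙ  ⟶ ⋯ ⟶ E₁  ⟶ Y  ⟶ 0
    |α    |          |     |β
0 ⟶ X' ⟶ Eₙ' ⟶ ⋯ ⟶ E₁' ⟶ Y' ⟶ 0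
```
with the prescribed morphisms `α` and `β` at the ends. -/
def HasMor {X X' : C} (α : X ⟶ X') : {n : ℕ} → {Y Y' : C} →
    𝓔.YonedaExtension X n Y → 𝓔.YonedaExtension X' n Y' → (Y ⟶ Y') → Prop
  | _, _, _, .hom f, .hom f', β => f ≫ α = β ≫ f'
  | _, _, _, .single (E := E) i p _, .single (E := E') i' p' _, β =>
      ∃ γ : E ⟶ E', i ≫ γ = α ≫ i' ∧ p ≫ β = γ ≫ p'
  | _, _, _, .splice (Z := Z) (E := E) i p _ ξ, .splice (Z := Z') (E := E') i' p' _ ξ', β =>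
      ∃ (ζ : Z ⟶ Z') (γ : E ⟶ E'), i ≫ γ = ζ ≫ i' ∧ p ≫ β = γ ≫ p' ∧ HasMor α ξ ξ' ζ

lemma HasMor.id {X : C} {n : ℕ} {Y : C} (ξ : 𝓔.YonedaExtension X n Y) :
    HasMor (𝟙 X) ξ ξ (𝟙 Y) := by
  induction ξ with
  | hom f => simp [HasMor]
  | single i p h => exact ⟨𝟙 _, by simp, by simp⟩
  | splice i p h ξ ih => exact ⟨𝟙 _, 𝟙 _, by simp, by simp, ih⟩

lemma HasMor.comp {X X' X'' : C} {α : X ⟶ X'} {α' : X' ⟶ X''} {n : ℕ} {Y : C}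
    (ξ : 𝓔.YonedaExtension X n Y) : ∀ {Y' Y'' : C} {β : Y ⟶ Y'} {β' : Y' ⟶ Y''}
    (ξ' : 𝓔.YonedaExtension X' n Y') (ξ'' : 𝓔.YonedaExtension X'' n Y''),
    HasMor α ξ ξ' β → HasMor α' ξ' ξ'' β' → HasMor (α ≫ α') ξ ξ'' (β ≫ β') := by
  induction ξ with
  | hom f =>
    rintro _ _ _ _ (_ | _ | _) (_ | _ | _) h h'
    simp only [HasMor] at h h' ⊢
    rw [reassoc_of% h, h', Category.assoc]
  | single i p h =>
    rintro _ _ _ _ (_ | _ | _) (_ | _ | _) ⟨γ, h₁, h₂⟩ ⟨γ', h₁', h₂'⟩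
    exact ⟨γ ≫ γ', by rw [reassoc_of% h₁, h₁', Category.assoc],
      by rw [reassoc_of% h₂, h₂', Category.assoc]⟩
  | splice i p h ξ ih =>
    rintro _ _ _ _ (_ | _ | ⟨i', p', _, ξ'⟩) (_ | _ | ⟨i'', p'', _, ξ''⟩) ⟨ζ, γ, h₁, h₂, h₃⟩
      ⟨ζ', γ', h₁', h₂', h₃'⟩
    exact ⟨ζ ≫ ζ', γ ≫ γ', by rw [reassoc_of% h₁, h₁', Category.assoc],
      by rw [reassoc_of% h₂, h₂', Category.assoc], ih _ _ h₃ h₃'⟩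

/-- The push-out of an extension along a morphism out of its left end. -/
lemma exists_pushout {X X' : C} {n : ℕ} {Y : C} (ξ : 𝓔.YonedaExtension X n Y) (α : X ⟶ X') :
    ∃ η : 𝓔.YonedaExtension X' n Y, HasMor α ξ η (𝟙 Y) ∧
      ∀ {X'' Y'' : C} (α' : X' ⟶ X'') (β : Y ⟶ Y'') (ξ'' : 𝓔.YonedaExtension X'' n Y''),
        HasMor (α ≫ α') ξ ξ'' β → HasMor α' η ξ'' β := by
  induction ξ with
  | hom f =>
    refine ⟨.hom (f ≫ α), by simp [HasMor], ?_⟩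
    rintro _ _ _ _ (_ | _ | _) h
    simpa [HasMor] using h
  | single i p h =>
    obtain ⟨B, f', i', p', sq, hc, hp⟩ := h.exists_pushout α
    refine ⟨.single i' p' hc, ⟨f', sq.w, by simp [hp]⟩, ?_⟩
    rintro _ _ α' β (_ | ⟨i'', p'', h''⟩ | _) ⟨γ, h₁, h₂⟩
    refine ⟨sq.desc γ (α' ≫ i'') (by simpa using h₁), by simp, sq.hom_ext ?_ ?_⟩
    · simp [reassoc_of% hp, h₂]
    · simp [reassoc_of% hc.zero, h''.zero]
  | splice i p h ξ ih =>
    obtain ⟨η, hη, hη'⟩ := ih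
    refine ⟨.splice i p h η, ⟨𝟙 _, 𝟙 _, by simp, by simp, hη⟩, ?_⟩
    rintro _ _ α' β (_ | _ | ⟨i'', p'', h'', ξ''⟩) ⟨ζ, γ, h₁, h₂, h₃⟩
    exact ⟨ζ, γ, h₁, h₂, hη' _ _ _ h₃⟩

/-- The pull-back of an extension along a morphism into its right end. -/
lemma exists_pullback {X : C} {n : ℕ} {Y Y' : C} (ξ : 𝓔.YonedaExtension X n Y) (β : Y' ⟶ Y) :
    ∃ η : 𝓔.YonedaExtension X n Y', HasMor (𝟙 X) η ξ β ∧
      ∀ {X'' Y'' : C} (α : X'' ⟶ X) (β' : Y'' ⟶ Y') (ξ'' : 𝓔.YonedaExtension X'' n Y''),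
        HasMor α ξ'' ξ (β' ≫ β) → HasMor α ξ'' η β' := by
  cases ξ with
  | hom f =>
    refine ⟨.hom (β ≫ f), by simp [HasMor], ?_⟩
    rintro _ _ _ _ (_ | _ | _) h
    simpa [HasMor] using h
  | single i p h =>
    obtain ⟨B, f', i', p', sq, hc, hp⟩ := h.exists_pullback β
    refine ⟨.single i' p' hc, ⟨f', by simp [hp], sq.w.symm⟩, ?_⟩
    rintro _ _ α β' (_ | ⟨i'', p'', h''⟩ | _) ⟨γ, h₁, h₂⟩
    refine ⟨sq.lift γ (p'' ≫ β') (by simpa using h₂.symm), sq.hom_ext ?_ ?_, by simp⟩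
    · simp [hp, h₁]
    · simp [hc.zero, reassoc_of% h''.zero]
  | splice i p h ξ =>
    obtain ⟨B, f', i', p', sq, hc, hp⟩ := h.exists_pullback β
    refine ⟨.splice i' p' hc ξ, ⟨𝟙 _, f', by simp [hp], sq.w.symm, HasMor.id ξ⟩, ?_⟩
    rintro _ _ α β' (_ | _ | ⟨i'', p'', h'', ξ''⟩) ⟨ζ, γ, h₁, h₂, h₃⟩
    refine ⟨ζ, sq.lift γ (p'' ≫ β') (by simpa using h₂.symm), sq.hom_ext ?_ ?_, by simp, h₃⟩
    · simp [hp, h₁]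
    · simp [hc.zero, reassoc_of% h''.zero]

section

variable [HasBinaryBiproducts C]

/-- The direct sum of two extensions. -/
noncomputable def sum {X X' : C} : {n : ℕ} → {Y Y' : C} → 𝓔.YonedaExtension X n Y →
    𝓔.YonedaExtension X' n Y' → 𝓔.YonedaExtension (X ⊞ X') n (Y ⊞ Y')
  | _, _, _, .hom f, .hom f' => .hom (biprod.map f f')
  | _, _, _, .single i p h, .single i' p' h' =>
      .single (biprod.map i i') (biprod.map p p') (h.biprod_map h')
  | _, _, _, .splice i p h ξ, .splice i' p' h' ξ' =>
      .splice (biprod.map i i') (biprod.map p p') (h.biprod_map h') (sum ξ ξ')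

lemma HasMor.sum_map {X X' X₁ X₁' : C} {α : X ⟶ X₁} {α' : X' ⟶ X₁'} {n : ℕ} {Y : C}
    (ξ : 𝓔.YonedaExtension X n Y) : ∀ {Y' Y₁ Y₁' : C} {β : Y ⟶ Y₁} {β' : Y' ⟶ Y₁'}
    (ξ' : 𝓔.YonedaExtension X' n Y') (ξ₁ : 𝓔.YonedaExtension X₁ n Y₁)
    (ξ₁' : 𝓔.YonedaExtension X₁' n Y₁'), HasMor α ξ ξ₁ β → HasMor α' ξ' ξ₁' β' →
      HasMor (biprod.map α α') (sum ξ ξ') (sum ξ₁ ξ₁') (biprod.map β β') := by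
  induction ξ with
  | hom f =>
    rintro _ _ _ _ _ (_ | _ | _) (_ | _ | _) (_ | _ | _) h h'
    simp only [HasMor, sum] at h h' ⊢
    ext <;> simp [h, h']
  | single i p h =>
    rintro _ _ _ _ _ (_ | _ | _) (_ | _ | _) (_ | _ | _) ⟨γ, h₁, h₂⟩ ⟨γ', h₁', h₂'⟩
    exact ⟨biprod.map γ γ', by ext <;> simp [h₁, h₁'], by ext <;> simp [h₂, h₂']⟩
  | splice i p h ξ ih =>
    rintro _ _ _ _ _ (_ | _ | _) (_ | _ | _) (_ | _ | _) ⟨ζ, γ, h₁, h₂, h₃⟩ ⟨ζ', γ', h₁', h₂', h₃'⟩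
    exact ⟨biprod.map ζ ζ', biprod.map γ γ', by ext <;> simp [h₁, h₁'], by ext <;> simp [h₂, h₂'],
      ih _ _ _ h₃ h₃'⟩

lemma HasMor.diag {X : C} {n : ℕ} {Y : C} (ξ : 𝓔.YonedaExtension X n Y) :
    HasMor (biprod.lift (𝟙 X) (𝟙 X)) ξ (sum ξ ξ) (biprod.lift (𝟙 Y) (𝟙 Y)) := by
  induction ξ with
  | hom f => simp only [HasMor, sum]; ext <;> simp
  | single i p h => exact ⟨biprod.lift (𝟙 _) (𝟙 _), by ext <;> simp, by ext <;> simp⟩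
  | splice i p h ξ ih =>
    exact ⟨biprod.lift (𝟙 _) (𝟙 _), biprod.lift (𝟙 _) (𝟙 _), by ext <;> simp, by ext <;> simp, ih⟩

lemma HasMor.swap {X X' : C} {n : ℕ} {Y : C} (ξ : 𝓔.YonedaExtension X n Y) :
    ∀ {Y' : C} (ξ' : 𝓔.YonedaExtension X' n Y'), HasMor (biprod.braiding X X').hom (sum ξ ξ')
      (sum ξ' ξ) (biprod.braiding Y Y').hom := by
  induction ξ with
  | hom f =>
    rintro _ (_ | _ | _)
    simp only [HasMor, sum]; ext <;> simp
  | single i p h =>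
    rintro _ (_ | _ | _)
    exact ⟨(biprod.braiding _ _).hom, by ext <;> simp, by ext <;> simp⟩
  | splice i p h ξ ih =>
    rintro _ (_ | _ | _)
    exact ⟨(biprod.braiding _ _).hom, (biprod.braiding _ _).hom, by ext <;> simp, by ext <;> simp,
      ih _⟩

lemma HasMor.assoc {X X' X'' : C} {n : ℕ} {Y : C} (ξ : 𝓔.YonedaExtension X n Y) :
    ∀ {Y' Y'' : C} (ξ' : 𝓔.YonedaExtension X' n Y') (ξ'' : 𝓔.YonedaExtension X'' n Y''),
      HasMor (biprod.associator X X' X'').hom (sum (sum ξ ξ') ξ'') (sum ξ (sum ξ' ξ''))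
        (biprod.associator Y Y' Y'').hom := by
  induction ξ with
  | hom f =>
    rintro _ _ (_ | _ | _) (_ | _ | _)
    simp only [HasMor, sum]; ext <;> simp
  | single i p h =>
    rintro _ _ (_ | _ | _) (_ | _ | _)
    exact ⟨(biprod.associator _ _ _).hom, by ext <;> simp, by ext <;> simp⟩
  | splice i p h ξ ih =>
    rintro _ _ (_ | _ | _) (_ | _ | _)
    exact ⟨(biprod.associator _ _ _).hom, (biprod.associator _ _ _).hom, by ext <;> simp,
      by ext <;> simp, ih _ _⟩

open scoped ZeroObject in
variable (𝓔) in
/-- The trivial `n`-fold extension: the zero morphism for `n = 0`, the split conflation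
`X ⟶ X ⊞ Y ⟶ Y` for `n = 1`, and `0 ⟶ X ⟶ X ⊞ 0 ⟶ 0 ⟶ ⋯ ⟶ 0 ⟶ Y ⟶ Y ⟶ 0` for `n ≥ 2`. -/
noncomputable def trivial [HasZeroObject C] (X : C) : (n : ℕ) → (Y : C) → 𝓔.YonedaExtension X n Y
  | 0, _ => .hom 0
  | 1, Y => .single biprod.inl biprod.snd (𝓔.isConflation_split X Y)
  | n + 2, Y => .splice 0 (𝟙 Y) (𝓔.isConflation_zero_id (isZero_zero C) Y)
      (trivial X (n + 1) (0 : C))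

lemma HasMor.to_trivial [HasZeroObject C] {X X' : C} {n : ℕ} {Y Y' : C}
    (ξ : 𝓔.YonedaExtension X n Y) (β : Y ⟶ Y') : HasMor (0 : X ⟶ X') ξ (trivial 𝓔 X' n Y') β := by
  induction ξ generalizing Y' with
  | hom f => simp [HasMor, trivial]
  | single i p h => exact ⟨p ≫ β ≫ biprod.inr, by simp [reassoc_of% h.zero], by simp⟩
  | splice i p h ξ ih => exact ⟨0, p ≫ β, by simp [reassoc_of% h.zero], by simp, ih _⟩

end

end YonedaExtension

open YonedaExtension

variable (𝓔)

/-- The Yoneda extension group `Extⁿ(Y, X)` of an exact category: the classes of `n`-fold extensions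
of `Y` by `X` under the equivalence relation generated by the morphisms of extensions that are the
identity at both ends. In degree `0` this is the group of morphisms `Y ⟶ X`. -/
def Ext (n : ℕ) (Y X : C) : Type (max u v) :=
  Quot fun ξ η : 𝓔.YonedaExtension X n Y => HasMor (𝟙 X) ξ η (𝟙 Y)

variable {𝓔}

namespace Ext

variable {n : ℕ}

/-- The class of an `n`-fold extension. -/
def mk {Y X : C} (ξ : 𝓔.YonedaExtension X n Y) : 𝓔.Ext n Y X := Quot.mk _ ξ

lemma mk_eq {Y X : C} {ξ η : 𝓔.YonedaExtension X n Y} (h : HasMor (𝟙 X) ξ η (𝟙 Y)) :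
    mk ξ = mk η := Quot.sound h

lemma exists_mk {Y X : C} (x : 𝓔.Ext n Y X) : ∃ ξ : 𝓔.YonedaExtension X n Y, mk ξ = x :=
  Quot.exists_rep x

/-- Covariant functoriality of `Extⁿ(Y, X)` in `X`, by push-out. -/
noncomputable def push {X X' : C} (α : X ⟶ X') {Y : C} : 𝓔.Ext n Y X → 𝓔.Ext n Y X' :=
  Quot.lift (fun ξ => mk (ξ.exists_pushout α).choose) fun ξ η h => mk_eq <| by
    have hη := (η.exists_pushout α).choose_spec.1
    refine (ξ.exists_pushout α).choose_spec.2 (𝟙 X') (𝟙 Y) _ ?_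
    simpa using HasMor.comp _ _ _ h hη

/-- Contravariant functoriality of `Extⁿ(Y, X)` in `Y`, by pull-back. -/
noncomputable def pull {Y Y' : C} (β : Y' ⟶ Y) {X : C} : 𝓔.Ext n Y X → 𝓔.Ext n Y' X :=
  Quot.lift (fun ξ => mk (ξ.exists_pullback β).choose) fun ξ η h => mk_eq <| by
    have hξ := (ξ.exists_pullback β).choose_spec.1
    refine (η.exists_pullback β).choose_spec.2 (𝟙 X) (𝟙 Y') _ ?_
    simpa using HasMor.comp _ _ _ hξ h

lemma push_mk_eq_pull_mk {X X' Y Y' : C} {α : X ⟶ X'} {β : Y ⟶ Y'} {ξ : 𝓔.YonedaExtension X n Y}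
    {η : 𝓔.YonedaExtension X' n Y'} (h : HasMor α ξ η β) : push α (mk ξ) = pull β (mk η) := by
  refine mk_eq ?_
  refine (η.exists_pullback β).choose_spec.2 _ _ _ ?_
  refine (ξ.exists_pushout α).choose_spec.2 _ _ _ ?_
  simpa using h

lemma exists_push_mk {X X' Y : C} (α : X ⟶ X') (ξ : 𝓔.YonedaExtension X n Y) :
    ∃ η : 𝓔.YonedaExtension X' n Y, push α (mk ξ) = mk η ∧ HasMor α ξ η (𝟙 Y) :=
  ⟨_, rfl, (ξ.exists_pushout α).choose_spec.1⟩

lemma exists_pull_mk {X Y Y' : C} (β : Y' ⟶ Y) (ξ : 𝓔.YonedaExtension X n Y) :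
    ∃ η : 𝓔.YonedaExtension X n Y', pull β (mk ξ) = mk η ∧ HasMor (𝟙 X) η ξ β :=
  ⟨_, rfl, (ξ.exists_pullback β).choose_spec.1⟩

@[simp]
lemma push_id {X Y : C} (x : 𝓔.Ext n Y X) : push (𝟙 X) x = x := by
  obtain ⟨ξ, rfl⟩ := exists_mk x
  obtain ⟨η, hη, h⟩ := exists_push_mk (𝟙 X) ξ
  rw [hη, mk_eq h]

@[simp]
lemma pull_id {X Y : C} (x : 𝓔.Ext n Y X) : pull (𝟙 Y) x = x := by
  obtain ⟨ξ, rfl⟩ := exists_mk x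
  obtain ⟨η, hη, h⟩ := exists_pull_mk (𝟙 Y) ξ
  rw [hη, mk_eq h]

lemma push_mk_eq {X X' Y : C} {α : X ⟶ X'} {ξ : 𝓔.YonedaExtension X n Y}
    {η : 𝓔.YonedaExtension X' n Y} (h : HasMor α ξ η (𝟙 Y)) : push α (mk ξ) = mk η := by
  rw [push_mk_eq_pull_mk h, pull_id]

lemma pull_mk_eq {X Y Y' : C} {β : Y ⟶ Y'} {ξ : 𝓔.YonedaExtension X n Y}
    {η : 𝓔.YonedaExtension X n Y'} (h : HasMor (𝟙 X) ξ η β) : pull β (mk η) = mk ξ := by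
  rw [← push_mk_eq_pull_mk h, push_id]

lemma push_push {X X' X'' Y : C} (α : X ⟶ X') (α' : X' ⟶ X'') (x : 𝓔.Ext n Y X) :
    push α' (push α x) = push (α ≫ α') x := by
  obtain ⟨ξ, rfl⟩ := exists_mk x
  obtain ⟨η, hη, h⟩ := exists_push_mk α ξ
  obtain ⟨η', hη', h'⟩ := exists_push_mk α' η
  rw [hη, hη', push_mk_eq]
  simpa using HasMor.comp _ _ _ h h'

lemma pull_pull {X Y Y' Y'' : C} (β : Y ⟶ Y') (β' : Y' ⟶ Y'') (x : 𝓔.Ext n Y'' X) :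
    pull β (pull β' x) = pull (β ≫ β') x := by
  obtain ⟨ξ, rfl⟩ := exists_mk x
  obtain ⟨η, hη, h⟩ := exists_pull_mk β' ξ
  obtain ⟨η', hη', h'⟩ := exists_pull_mk β η
  rw [hη, hη', pull_mk_eq]
  simpa using HasMor.comp _ _ _ h' h

lemma push_pull {X X' Y Y' : C} (α : X ⟶ X') (β : Y ⟶ Y') (x : 𝓔.Ext n Y' X) :
    push α (pull β x) = pull β (push α x) := by
  obtain ⟨ξ, rfl⟩ := exists_mk x
  obtain ⟨η, hη, h⟩ := exists_pull_mk β ξ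
  obtain ⟨η', hη', h'⟩ := exists_push_mk α ξ
  rw [hη, hη', push_mk_eq_pull_mk]
  simpa using HasMor.comp _ _ _ h h'

section Group

variable [HasBinaryBiproducts C]

lemma biprod_map_id_id (X Y : C) : biprod.map (𝟙 X) (𝟙 Y) = 𝟙 (X ⊞ Y) := by
  ext <;> simp

/-- The direct sum of two extension classes. -/
noncomputable def sum {X X' Y Y' : C} : 𝓔.Ext n Y X → 𝓔.Ext n Y' X' →
    𝓔.Ext n (Y ⊞ Y') (X ⊞ X') :=
  Quot.map₂ YonedaExtension.sum
    (fun ξ η η' h => by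
      simpa only [biprod_map_id_id] using HasMor.sum_map _ _ _ _ (HasMor.id ξ) h)
    (fun ξ ξ' η h => by
      simpa only [biprod_map_id_id] using HasMor.sum_map _ _ _ _ h (HasMor.id η))

lemma sum_mk {X X' Y Y' : C} (ξ : 𝓔.YonedaExtension X n Y) (η : 𝓔.YonedaExtension X' n Y') :
    sum (mk ξ) (mk η) = mk (ξ.sum η) := rfl

lemma push_sum {X X' X₁ X₁' Y Y' : C} (α : X ⟶ X₁) (α' : X' ⟶ X₁') (x : 𝓔.Ext n Y X)
    (y : 𝓔.Ext n Y' X') : sum (push α x) (push α' y) = push (biprod.map α α') (sum x y) := by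
  obtain ⟨ξ, rfl⟩ := exists_mk x
  obtain ⟨η, rfl⟩ := exists_mk y
  obtain ⟨ξ', hξ, h⟩ := exists_push_mk α ξ
  obtain ⟨η', hη, h'⟩ := exists_push_mk α' η
  rw [hξ, hη, sum_mk, sum_mk, push_mk_eq]
  simpa only [biprod_map_id_id] using HasMor.sum_map _ _ _ _ h h'

lemma pull_sum {X X' Y Y' Y₁ Y₁' : C} (β : Y₁ ⟶ Y) (β' : Y₁' ⟶ Y') (x : 𝓔.Ext n Y X)
    (y : 𝓔.Ext n Y' X') : sum (pull β x) (pull β' y) = pull (biprod.map β β') (sum x y) := by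
  obtain ⟨ξ, rfl⟩ := exists_mk x
  obtain ⟨η, rfl⟩ := exists_mk y
  obtain ⟨ξ', hξ, h⟩ := exists_pull_mk β ξ
  obtain ⟨η', hη, h'⟩ := exists_pull_mk β' η
  rw [hξ, hη, sum_mk, sum_mk, pull_mk_eq]
  simpa only [biprod_map_id_id] using HasMor.sum_map _ _ _ _ h h'

/-- The Baer sum `∇ (x ⊕ y) Δ`. -/
noncomputable instance {Y X : C} : Add (𝓔.Ext n Y X) where
  add x y := push (biprod.desc (𝟙 X) (𝟙 X)) (pull (biprod.lift (𝟙 Y) (𝟙 Y)) (sum x y))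

lemma add_def {Y X : C} (x y : 𝓔.Ext n Y X) :
    x + y = push (biprod.desc (𝟙 X) (𝟙 X)) (pull (biprod.lift (𝟙 Y) (𝟙 Y)) (sum x y)) := rfl

lemma push_add {X X' Y : C} (α : X ⟶ X') (x y : 𝓔.Ext n Y X) :
    push α (x + y) = push α x + push α y := by
  rw [add_def, add_def, push_sum, ← push_pull, push_push, push_push]
  congr 1
  ext <;> simp

lemma pull_add {X Y Y' : C} (β : Y' ⟶ Y) (x y : 𝓔.Ext n Y X) :
    pull β (x + y) = pull β x + pull β y := by
  rw [add_def, add_def, pull_sum, ← push_pull, pull_pull, pull_pull]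
  congr 2
  ext <;> simp

lemma push_diag {X Y : C} (x : 𝓔.Ext n Y X) :
    push (biprod.lift (𝟙 X) (𝟙 X)) x = pull (biprod.lift (𝟙 Y) (𝟙 Y)) (sum x x) := by
  obtain ⟨ξ, rfl⟩ := exists_mk x
  exact push_mk_eq_pull_mk (HasMor.diag ξ)

lemma push_add_push {X X' Y : C} (α α' : X ⟶ X') (x : 𝓔.Ext n Y X) :
    push α x + push α' x = push (α + α') x := by
  rw [add_def, push_sum, ← push_pull, ← push_diag, push_push, push_push]
  have e : biprod.map α α' ≫ biprod.desc (𝟙 X') (𝟙 X') = biprod.desc α α' := by ext <;> simp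
  rw [e, biprod.add_eq_lift_id_desc]

lemma add_comm' {X Y : C} (x y : 𝓔.Ext n Y X) : x + y = y + x := by
  have key : push (biprod.braiding X X).hom (sum x y) =
      pull (biprod.braiding Y Y).hom (sum y x) := by
    obtain ⟨ξ, rfl⟩ := exists_mk x
    obtain ⟨η, rfl⟩ := exists_mk y
    exact push_mk_eq_pull_mk (HasMor.swap ξ η)
  have e₁ : (biprod.desc (𝟙 X) (𝟙 X) : X ⊞ X ⟶ X) =
    (biprod.braiding X X).hom ≫ biprod.desc (𝟙 X) (𝟙 X) := by ext <;> simp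
  have e₂ : (biprod.lift (𝟙 Y) (𝟙 Y) : Y ⟶ Y ⊞ Y) ≫ (biprod.braiding Y Y).hom =
    biprod.lift (𝟙 Y) (𝟙 Y) := by ext <;> simp
  rw [add_def, add_def, e₁, ← push_push, push_pull, key, pull_pull, e₂, ← e₁]

lemma add_assoc' {X Y : C} (x y z : 𝓔.Ext n Y X) : x + y + z = x + (y + z) := by
  have key : push (biprod.associator X X X).hom (sum (sum x y) z) =
      pull (biprod.associator Y Y Y).hom (sum x (sum y z)) := by
    obtain ⟨ξ, rfl⟩ := exists_mk x
    obtain ⟨η, rfl⟩ := exists_mk y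
    obtain ⟨θ, rfl⟩ := exists_mk z
    exact push_mk_eq_pull_mk (HasMor.assoc ξ η θ)
  have h₁ : x + y + z = push (biprod.desc (biprod.desc (𝟙 X) (𝟙 X)) (𝟙 X))
      (pull (biprod.lift (biprod.lift (𝟙 Y) (𝟙 Y)) (𝟙 Y)) (sum (sum x y) z)) := by
    rw [add_def, add_def]
    have aux : ∀ s : 𝓔.Ext n (Y ⊞ Y) (X ⊞ X),
        sum (push (biprod.desc (𝟙 X) (𝟙 X)) (pull (biprod.lift (𝟙 Y) (𝟙 Y)) s)) z =
          push (biprod.map (biprod.desc (𝟙 X) (𝟙 X)) (𝟙 X))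
            (pull (biprod.map (biprod.lift (𝟙 Y) (𝟙 Y)) (𝟙 Y)) (sum s z)) := fun s => by
      rw [← pull_sum, ← push_sum, push_id, pull_id]
    rw [aux, ← push_pull, pull_pull, push_push]
    congr 2 <;> ext <;> simp
  have h₂ : x + (y + z) = push (biprod.desc (𝟙 X) (biprod.desc (𝟙 X) (𝟙 X)))
      (pull (biprod.lift (𝟙 Y) (biprod.lift (𝟙 Y) (𝟙 Y))) (sum x (sum y z))) := by
    rw [add_def, add_def]
    have aux : ∀ s : 𝓔.Ext n (Y ⊞ Y) (X ⊞ X),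
        sum x (push (biprod.desc (𝟙 X) (𝟙 X)) (pull (biprod.lift (𝟙 Y) (𝟙 Y)) s)) =
          push (biprod.map (𝟙 X) (biprod.desc (𝟙 X) (𝟙 X)))
            (pull (biprod.map (𝟙 Y) (biprod.lift (𝟙 Y) (𝟙 Y))) (sum x s)) := fun s => by
      rw [← pull_sum, ← push_sum, push_id, pull_id]
    rw [aux, ← push_pull, pull_pull, push_push]
    congr 2 <;> ext <;> simp
  have e₁ : (biprod.desc (biprod.desc (𝟙 X) (𝟙 X)) (𝟙 X)) =
    (biprod.associator X X X).hom ≫ biprod.desc (𝟙 X) (biprod.desc (𝟙 X) (𝟙 X)) := by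
      ext <;> simp
  have e₂ : biprod.lift (biprod.lift (𝟙 Y) (𝟙 Y)) (𝟙 Y) ≫ (biprod.associator Y Y Y).hom =
    biprod.lift (𝟙 Y) (biprod.lift (𝟙 Y) (𝟙 Y)) := by ext <;> simp
  rw [h₁, h₂, e₁, ← push_push, push_pull, key, pull_pull, e₂]

variable [HasZeroObject C]

noncomputable instance {Y X : C} : Zero (𝓔.Ext n Y X) where
  zero := mk (YonedaExtension.trivial 𝓔 X n Y)

noncomputable instance {Y X : C} : Neg (𝓔.Ext n Y X) where
  neg x := push (-𝟙 X) x

lemma push_zero_mor {X X' Y : C} (x : 𝓔.Ext n Y X) : push (0 : X ⟶ X') x = 0 := by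
  obtain ⟨ξ, rfl⟩ := exists_mk x
  exact push_mk_eq (HasMor.to_trivial ξ _)

lemma add_zero' {X Y : C} (x : 𝓔.Ext n Y X) : x + 0 = x := by
  rw [← push_zero_mor (X' := X) x]
  nth_rw 1 [← push_id x]
  rw [push_add_push, add_zero, push_id]

/-- The Yoneda extension groups are abelian groups under Baer sum. -/
noncomputable instance {Y X : C} : AddCommGroup (𝓔.Ext n Y X) where
  add_assoc := add_assoc'
  add_comm := add_comm'
  add_zero := add_zero'
  zero_add x := by rw [add_comm', add_zero']
  neg_add_cancel x := by
    change push (-𝟙 X) x + x = 0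
    nth_rw 2 [← push_id x]
    rw [push_add_push, neg_add_cancel, push_zero_mor]
  nsmul := nsmulRec
  zsmul := zsmulRec

end Group

end Ext

end ExactStructure
end Exact

section Induced

open Opposite

variable {C : Type u} [Category.{v} C] [Preadditive C] {𝓔 : ExactStructure C}
variable {A : Type u'} [Category.{v'} A] [Abelian A]

namespace ExactStructure.YonedaExtension

/-- The image of an extension under a covariant functor to an abelian category is an exact
sequence, that is, all the conflations it is spliced from become short exact. -/
def MapExact (F : C ⥤ A) [F.Additive] {X : C} :
    {n : ℕ} → {Y : C} → 𝓔.YonedaExtension X n Y → Prop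
  | _, _, .hom _ => True
  | _, _, .single i p h => ((ShortComplex.mk i p h.zero).map F).ShortExact
  | _, _, .splice i p h ξ => ((ShortComplex.mk i p h.zero).map F).ShortExact ∧ MapExact F ξ

/-- The class in `Extⁿ(F Y, F X)` of the image under a covariant functor `F` of an `n`-fold
extension of `Y` by `X` that remains exact: the Yoneda product of the classes of the short exact
sequences it is spliced from. -/
noncomputable def mapClass [HasExt.{w} A] (F : C ⥤ A) [F.Additive] {X : C} :
    {n : ℕ} → {Y : C} → (ξ : 𝓔.YonedaExtension X n Y) → ξ.MapExact F →
      Abelian.Ext.{w} (F.obj Y) (F.obj X) n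
  | _, _, .hom f, _ => .mk₀ (F.map f)
  | _, _, .single _ _ _, hξ => ShortComplex.ShortExact.extClass hξ
  | n + 2, _, .splice _ _ _ ξ, hξ =>
      (ShortComplex.ShortExact.extClass hξ.1).comp (mapClass F ξ hξ.2) (add_comm 1 (n + 1))

/-- The short complex `G Z ⟶ G B ⟶ G A` obtained by applying a contravariant functor to a conflation
`A ⟶ B ⟶ Z`. -/
abbrev opMapShortComplex (G : Cᵒᵖ ⥤ A) [G.Additive] {X B Z : C} {i : X ⟶ B} {p : B ⟶ Z}
    (h : 𝓔.IsConflation i p) : ShortComplex A :=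
  (ShortComplex.mk i p h.zero).op.map G

/-- The image of an extension under a contravariant functor to an abelian category is an exact
sequence, that is, all the conflations it is spliced from become short exact. -/
def OpMapExact (G : Cᵒᵖ ⥤ A) [G.Additive] {X : C} :
    {n : ℕ} → {Y : C} → 𝓔.YonedaExtension X n Y → Prop
  | _, _, .hom _ => True
  | _, _, .single _ _ h => (opMapShortComplex G h).ShortExact
  | _, _, .splice _ _ h ξ => (opMapShortComplex G h).ShortExact ∧ OpMapExact G ξ

/-- The class in `Extⁿ(G X, G Y)` of the image under a contravariant functor `G` of an `n`-fold
extension of `Y` by `X` that remains exact: the Yoneda product of the classes of the short exact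
sequences it is spliced from. -/
noncomputable def opMapClass [HasExt.{w} A] (G : Cᵒᵖ ⥤ A) [G.Additive] {X : C} :
    {n : ℕ} → {Y : C} → (ξ : 𝓔.YonedaExtension X n Y) → ξ.OpMapExact G →
      Abelian.Ext.{w} (G.obj (op X)) (G.obj (op Y)) n
  | _, _, .hom f, _ => .mk₀ (G.map f.op)
  | _, _, .single _ _ _, hξ => ShortComplex.ShortExact.extClass hξ
  | _, _, .splice _ _ _ ξ, hξ =>
      (opMapClass G ξ hξ.2).comp (ShortComplex.ShortExact.extClass hξ.1) rfl

end ExactStructure.YonedaExtension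

end Induced

section Subcategory

variable {C : Type u} [Category.{v} C] [Preadditive C]

/-- The contravariant functor `Ψ : X ↦ Hom(X, -)|_M` from `C` to the category `M-Mod` of left
`M`-modules (covariant additive functors from `M` to abelian groups). -/
def psi (M : ObjectProperty C) : Cᵒᵖ ⥤ (M.FullSubcategory ⥤+ AddCommGrpCat.{v}) where
  obj X := AdditiveFunctor.of (M.ι ⋙ preadditiveCoyoneda.obj X)
  map f := ⟨M.ι.whiskerLeft (preadditiveCoyoneda.map f)⟩

/-- The functor `Φ : X ↦ Hom(-, X)|_M` from `C` to the category `Mod-M` of right `M`-modules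
(contravariant additive functors from `M` to abelian groups). -/
def phi (M : ObjectProperty C) : C ⥤ (M.FullSubcategoryᵒᵖ ⥤+ AddCommGrpCat.{v}) where
  obj X := AdditiveFunctor.of (M.ι.op ⋙ preadditiveYoneda.obj X)
  map f := ⟨M.ι.op.whiskerLeft (preadditiveYoneda.map f)⟩

instance (M : ObjectProperty C) : (psi M).Additive where
  map_add {X Y f g} := by
    ext N x
    exact Preadditive.add_comp _ _ _ _ _ _

instance (M : ObjectProperty C) : (phi M).Additive where
  map_add {X Y f g} := by
    ext N x
    exact Preadditive.comp_add _ _ _ _ _ _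

namespace ExactStructure

variable (𝓔 : ExactStructure C)

/-- The objects `X` of `cogenᵏ(M)`: there is an exact sequence
`0 ⟶ X ⟶ M₀ ⟶ ⋯ ⟶ Mₖ ⟶ Z ⟶ 0` with all `Mⱼ` in `M`, spliced from conflations
`Zⱼ ⟶ Mⱼ ⟶ Zⱼ₊₁` for `0 ≤ j ≤ k` with `Z₀ = X` and `Zₖ₊₁ = Z`, such that
`Hom(Mₖ, N) ⟶ ⋯ ⟶ Hom(M₀, N) ⟶ Hom(X, N) ⟶ 0` is exact for all `N` in `M`.
The values of the sequences at indices beyond those above are irrelevant. -/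
def cogen (M : ObjectProperty C) (k : ℕ) : ObjectProperty C := fun X =>
  ∃ (Z M' : ℕ → C) (ι : ∀ j, Z j ⟶ M' j) (π : ∀ j, M' j ⟶ Z (j + 1)),
    Z 0 = X ∧ (∀ j ≤ k, M (M' j) ∧ 𝓔.IsConflation (ι j) (π j)) ∧
    ∀ N : C, M N →
      Function.Surjective (fun g : M' 0 ⟶ N => ι 0 ≫ g) ∧
      (0 < k → Function.Exact (fun g : M' 1 ⟶ N => (π 0 ≫ ι 1) ≫ g)
        (fun g : M' 0 ⟶ N => ι 0 ≫ g)) ∧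
      ∀ j, j + 1 < k → Function.Exact (fun g : M' (j + 2) ⟶ N => (π (j + 1) ≫ ι (j + 2)) ≫ g)
        (fun g : M' (j + 1) ⟶ N => (π j ≫ ι (j + 1)) ≫ g)

/-- The objects `X` of `genₖ(M)`: there is an exact sequence
`0 ⟶ Z ⟶ Mₖ ⟶ ⋯ ⟶ M₀ ⟶ X ⟶ 0` with all `Mⱼ` in `M`, spliced from conflations
`Zⱼ₊₁ ⟶ Mⱼ ⟶ Zⱼ` for `0 ≤ j ≤ k` with `Z₀ = X` and `Zₖ₊₁ = Z`, such that
`Hom(N, Mₖ) ⟶ ⋯ ⟶ Hom(N, M₀) ⟶ Hom(N, X) ⟶ 0` is exact for all `N` in `M`.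
The values of the sequences at indices beyond those above are irrelevant. -/
def gen (M : ObjectProperty C) (k : ℕ) : ObjectProperty C := fun X =>
  ∃ (Z M' : ℕ → C) (ι : ∀ j, Z (j + 1) ⟶ M' j) (π : ∀ j, M' j ⟶ Z j),
    Z 0 = X ∧ (∀ j ≤ k, M (M' j) ∧ 𝓔.IsConflation (ι j) (π j)) ∧
    ∀ N : C, M N →
      Function.Surjective (fun g : N ⟶ M' 0 => g ≫ π 0) ∧
      (0 < k → Function.Exact (fun g : N ⟶ M' 1 => g ≫ π 1 ≫ ι 0)
        (fun g : N ⟶ M' 0 => g ≫ π 0)) ∧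
      ∀ j, j + 1 < k → Function.Exact (fun g : N ⟶ M' (j + 2) => g ≫ π (j + 2) ≫ ι (j + 1))
        (fun g : N ⟶ M' (j + 1) => g ≫ π (j + 1) ≫ ι j)

variable [HasZeroObject C] [HasBinaryBiproducts C]

/-- The objects `Y` with `Extⁱ(Y, N) = 0` for all `N` in `M` and `1 ≤ i < k`. -/
def leftExtOrthogonal (M : ObjectProperty C) (k : ℕ) : ObjectProperty C := fun Y =>
  ∀ i, 1 ≤ i → i < k → ∀ N : C, M N → ∀ x : 𝓔.Ext i Y N, x = 0

/-- The objects `X` with `Extⁱ(N, X) = 0` for all `N` in `M` and `1 ≤ i < k`. -/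
def rightExtOrthogonal (M : ObjectProperty C) (k : ℕ) : ObjectProperty C := fun X =>
  ∀ i, 1 ≤ i → i < k → ∀ N : C, M N → ∀ x : 𝓔.Ext i N X, x = 0

end ExactStructure

end Subcategory

/-! The proof is dimension shifting along the given (co)resolution. Let X → M₀ → Z be the first
conflation of the coresolution of X. Morphisms from X to objects of M extend to M₀, so Ψ makes it a
short exact sequence 0 → ΨZ → ΨM₀ → ΨX → 0, and ΨM₀ is projective by Yoneda. If i + 1 < k, then
Extⁱ⁺¹(Y, M₀) = 0, so Extⁱ⁺¹(Y, X) is the cokernel of Extⁱ(Y, M₀) → Extⁱ(Y, Z). Likewise Extⁱ⁺¹(ΨX,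
ΨY) is the cokernel of Extⁱ(ΨM₀, ΨY) → Extⁱ(ΨZ, ΨY). The middle groups are isomorphic by induction,
Z having a coresolution shorter by one. The images of the left groups correspond: by Yoneda if i =
0, and because both groups vanish if i > 0. In degree zero, Ψ is bijective on Hom(Y, X) by left
exactness and two steps of the coresolution (`psi_map_bijective`). Part (b) is dual
(`exists_addEquiv_phi`).

Two points need care. First, Yoneda classes are equal when joined by a zigzag of extensions, and the
intermediate extensions need not stay exact under Ψ, so taking images does not obviously descend to
classes. The induction therefore carries the relation `OpMapRel` ("some representative with exact
image has this class") and proves that it is the graph of an isomorphism. This uses that every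
Ψ-exact extension of positive degree is, up to equivalence and with the right image class, spliced
from X → M₀ → Z (`OpMapRel.exists_spliceLeft`). Naturality follows, since the relation is stable
under push-out and pull-back.

Second, the exact sequences for Yoneda Ext in an exact category are proved by hand. They rest on a
criterion free of zigzags: a spliced class vanishes only if its left factor dies on a refinement of
the right-most conflation (`exists_refinement_of_spliceRight_eq_zero`). Exactness then follows by
induction on the degree. -/

section
variable {C : Type u} [Category.{v} C] [Preadditive C] {𝓔 : ExactStructure C}

namespace ExactStructure

/-! ### Splittings, invariants of extension classes, additivity -/

namespace IsConflation

lemma deflation {A B Z : C} {i : A ⟶ B} {p : B ⟶ Z} (h : 𝓔.IsConflation i p) :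
    IsDeflationFor 𝓔.conflation p := ⟨_, i, h.1, h.2⟩

/-- The composition of two deflations is part of a conflation. -/
lemma exists_comp {A B Z A' Y : C} {i : A ⟶ B} {p : B ⟶ Z} (h : 𝓔.IsConflation i p)
    {i' : A' ⟶ Z} {p' : Z ⟶ Y} (h' : 𝓔.IsConflation i' p') :
    ∃ (K : C) (k : K ⟶ B), 𝓔.IsConflation k (p ≫ p') := by
  obtain ⟨K, k, w, hk⟩ := 𝓔.deflation_comp p p' h.deflation h'.deflation
  exact ⟨K, k, w, hk⟩

end IsConflation

open YonedaExtension

namespace YonedaExtension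

/-- The morphism underlying a `0`-fold extension. -/
def toHom {X Y : C} : 𝓔.YonedaExtension X 0 Y → (Y ⟶ X)
  | .hom f => f

/-- Counterpart of `HasMor.to_trivial` at the other end. It makes pull-back along zero vanish, and
it kills a class on the deflation of its own right-most conflation. -/
lemma HasMor.from_trivial [HasBinaryBiproducts C] [HasZeroObject C] {X : C} {n : ℕ} {Y Y' : C}
    (ξ : 𝓔.YonedaExtension X n Y) :
    HasMor (𝟙 X) (trivial 𝓔 X n Y') ξ (0 : Y' ⟶ Y) := by
  induction ξ generalizing Y' with
  | hom f => simp [HasMor, trivial]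
  | single i p h => exact ⟨biprod.desc i 0, by simp, by ext <;> simp [h.zero]⟩
  | splice i p h ξ ih => exact ⟨0, 0, by simp, by simp, ih⟩

lemma HasMor.codiag [HasBinaryBiproducts C] {X : C} {n : ℕ} {Y : C}
    (ξ : 𝓔.YonedaExtension X n Y) :
    HasMor (biprod.desc (𝟙 X) (𝟙 X)) (sum ξ ξ) ξ (biprod.desc (𝟙 Y) (𝟙 Y)) := by
  induction ξ with
  | hom f => simp only [HasMor, sum]; ext <;> simp
  | single i p h => exact ⟨biprod.desc (𝟙 _) (𝟙 _), by ext <;> simp, by ext <;> simp⟩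
  | splice i p h ξ ih =>
    exact ⟨biprod.desc (𝟙 _) (𝟙 _), biprod.desc (𝟙 _) (𝟙 _), by ext <;> simp, by ext <;> simp, ih⟩

/-- A `1`-fold extension is split if its inflation has a retraction. -/
def IsSplit {X Y : C} : 𝓔.YonedaExtension X 1 Y → Prop
  | .single (E := E) i _ _ => ∃ r : E ⟶ X, i ≫ r = 𝟙 X

end YonedaExtension

namespace IsConflation

lemma exists_section {A B Z : C} {i : A ⟶ B} {p : B ⟶ Z} (h : 𝓔.IsConflation i p)
    {r : B ⟶ A} (hr : i ≫ r = 𝟙 A) : ∃ s : Z ⟶ B, s ≫ p = 𝟙 Z := by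
  obtain ⟨s, hs⟩ := h.exists_desc (𝟙 B - r ≫ i) (by simp [reassoc_of% hr])
  have := h.epi
  exact ⟨s, by rw [← cancel_epi p, reassoc_of% hs]; simp [h.zero]⟩

lemma exists_retraction {A B Z : C} {i : A ⟶ B} {p : B ⟶ Z} (h : 𝓔.IsConflation i p)
    {s : Z ⟶ B} (hs : s ≫ p = 𝟙 Z) : ∃ r : B ⟶ A, i ≫ r = 𝟙 A := by
  obtain ⟨r, hr⟩ := h.exists_lift (𝟙 B - p ≫ s) (by simp [hs])
  have := h.mono
  exact ⟨r, by rw [← cancel_mono i, Category.assoc, hr]; simp [reassoc_of% h.zero]⟩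

end IsConflation

namespace Ext

variable {n : ℕ}

/-- The predicate is invariant under each generating morphism, hence descends to the quotient and no
zigzag has to be followed. Along a morphism that is the identity at both ends, sections move forward
and retractions move back. -/
lemma isSplit_iff_of_mk_eq {X Y : C} {ξ η : 𝓔.YonedaExtension X 1 Y} (h : mk ξ = mk η) :
    ξ.IsSplit ↔ η.IsSplit := by
  have key : ∀ ξ η : 𝓔.YonedaExtension X 1 Y, HasMor (𝟙 X) ξ η (𝟙 Y) →
      (ξ.IsSplit = η.IsSplit) := by
    rintro (_ | ⟨i, p, hc⟩ | _) (_ | ⟨i', p', hc'⟩ | _) ⟨γ, h₁, h₂⟩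
    rw [eq_iff_iff]
    constructor
    · rintro ⟨r, hr⟩
      obtain ⟨s, hs⟩ := hc.exists_section hr
      exact hc'.exists_retraction (s := s ≫ γ) (by rw [Category.assoc, ← h₂, reassoc_of% hs])
    · rintro ⟨r, hr⟩
      exact ⟨γ ≫ r, by rw [reassoc_of% h₁, hr]⟩
  exact iff_of_eq (congrArg (Quot.lift IsSplit key) h)

lemma mk_hom_eq_iff {X Y : C} {f g : Y ⟶ X} :
    (mk (.hom f) : 𝓔.Ext 0 Y X) = mk (.hom g) ↔ f = g := by
  refine ⟨fun h => ?_, by rintro rfl; rfl⟩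
  have key : ∀ ξ η : 𝓔.YonedaExtension X 0 Y, HasMor (𝟙 X) ξ η (𝟙 Y) → ξ.toHom = η.toHom := by
    rintro (_ | _ | _) (_ | _ | _) h
    simpa [HasMor, toHom] using h
  exact congrArg (Quot.lift toHom key) h

lemma push_mk_hom {X X' Y : C} (α : X ⟶ X') (f : Y ⟶ X) :
    push α (mk (.hom f) : 𝓔.Ext 0 Y X) = mk (.hom (f ≫ α)) :=
  push_mk_eq (by simp [HasMor])

lemma pull_mk_hom {X Y Y' : C} (β : Y' ⟶ Y) (f : Y ⟶ X) :
    pull β (mk (.hom f) : 𝓔.Ext 0 Y X) = mk (.hom (β ≫ f)) :=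
  pull_mk_eq (by simp [HasMor])

lemma exists_mk_hom {X Y : C} (x : 𝓔.Ext 0 Y X) : ∃ f : Y ⟶ X, x = mk (.hom f) := by
  obtain ⟨_ | _ | _, rfl⟩ := exists_mk x
  exact ⟨_, rfl⟩

variable [HasBinaryBiproducts C]

lemma pull_add_pull {X Y Y' : C} (β β' : Y' ⟶ Y) (x : 𝓔.Ext n Y X) :
    pull β x + pull β' x = pull (β + β') x := by
  have h : push (biprod.desc (𝟙 X) (𝟙 X)) (sum x x) = pull (biprod.desc (𝟙 Y) (𝟙 Y)) x := by
    obtain ⟨ξ, rfl⟩ := exists_mk x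
    exact push_mk_eq_pull_mk (HasMor.codiag ξ)
  rw [add_def, pull_sum, pull_pull, push_pull, h, pull_pull]
  congr 1
  have e : biprod.map β β' ≫ biprod.desc (𝟙 Y) (𝟙 Y) = biprod.desc β β' := by ext <;> simp
  rw [Category.assoc, e, biprod.add_eq_lift_id_desc]

lemma mk_hom_add {X Y : C} (f g : Y ⟶ X) :
    (mk (.hom (f + g)) : 𝓔.Ext 0 Y X) = mk (.hom f) + mk (.hom g) := by
  have := push_add_push f g (mk (.hom (𝟙 Y)) : 𝓔.Ext 0 Y Y)
  simpa [push_mk_hom] using this.symm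

/-- Extensions of degree zero are morphisms. -/
noncomputable def homAddEquiv (Y X : C) : (Y ⟶ X) ≃+ 𝓔.Ext 0 Y X :=
  AddEquiv.mk' (Equiv.ofBijective (fun f => mk (.hom f))
    ⟨fun _ _ h => mk_hom_eq_iff.1 h, fun x => (exists_mk_hom x).imp fun _ h => h.symm⟩) mk_hom_add

variable [HasZeroObject C]

lemma push_zero {X X' Y : C} (α : X ⟶ X') : push α (0 : 𝓔.Ext n Y X) = 0 := by
  rw [← push_zero_mor (X' := X) (0 : 𝓔.Ext n Y X), push_push, zero_comp, push_zero_mor]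

lemma pull_zero_mor {X Y Y' : C} (x : 𝓔.Ext n Y X) : pull (0 : Y' ⟶ Y) x = 0 := by
  obtain ⟨ξ, rfl⟩ := exists_mk x
  exact pull_mk_eq (HasMor.from_trivial ξ)

lemma pull_zero {X Y Y' : C} (β : Y' ⟶ Y) : pull β (0 : 𝓔.Ext n Y X) = 0 := by
  rw [← push_zero_mor (X' := X) (0 : 𝓔.Ext n Y X), ← push_pull, push_zero_mor]

/-- Naturality forces additivity: x and y are the two push-outs of a single class z on X ⊞ X, and a
sum of push-outs of z is the push-out of z along the sum of the morphisms. -/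
lemma map_add_of_push {m : ℕ} {Y Y' : C} (T : ∀ X : C, 𝓔.Ext n Y X → 𝓔.Ext m Y' X)
    (hT : ∀ {X X' : C} (α : X ⟶ X') (x : 𝓔.Ext n Y X), T X' (push α x) = push α (T X x))
    {X : C} (x y : 𝓔.Ext n Y X) : T X (x + y) = T X x + T X y := by
  let z : 𝓔.Ext n Y (X ⊞ X) := push biprod.inl x + push biprod.inr y
  have hx : push biprod.fst z = x := by simp [z, push_add, push_push, push_zero_mor]
  have hy : push biprod.snd z = y := by simp [z, push_add, push_push, push_zero_mor]
  rw [← hx, ← hy, push_add_push, hT, hT, hT, push_add_push]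

lemma map_add_of_pull {m : ℕ} {X X' : C} (T : ∀ Y : C, 𝓔.Ext n Y X → 𝓔.Ext m Y X')
    (hT : ∀ {Y Y' : C} (β : Y' ⟶ Y) (x : 𝓔.Ext n Y X), T Y' (pull β x) = pull β (T Y x))
    {Y : C} (x y : 𝓔.Ext n Y X) : T Y (x + y) = T Y x + T Y y := by
  let z : 𝓔.Ext n (Y ⊞ Y) X := pull biprod.fst x + pull biprod.snd y
  have hx : pull biprod.inl z = x := by simp [z, pull_add, pull_pull, pull_zero_mor]
  have hy : pull biprod.inr z = y := by simp [z, pull_add, pull_pull, pull_zero_mor]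
  rw [← hx, ← hy, pull_add_pull, hT, hT, hT, pull_add_pull]

end Ext

/-! ### Connecting maps given by splicing with a conflation -/

section Splice

namespace YonedaExtension

variable {Z E Y : C} {i : Z ⟶ E} {p : E ⟶ Y}

/-- The class of the extension obtained by splicing an extension of `Z` with a conflation
`Z ⟶ E ⟶ Y`. -/
noncomputable def spliceRight (h : 𝓔.IsConflation i p) {X : C} :
    {n : ℕ} → 𝓔.YonedaExtension X n Z → 𝓔.Ext (n + 1) Y X
  | 0, .hom g => Ext.push g (Ext.mk (.single i p h))
  | _ + 1, ξ => Ext.mk (.splice i p h ξ)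

/-- The one compatibility behind well-definedness on classes and naturality in all variables. Degree
zero is separate because splicing with a morphism means push-out. -/
lemma HasMor.spliceRight {n : ℕ} (h : 𝓔.IsConflation i p) {Z' E' Y' : C} {i' : Z' ⟶ E'}
    {p' : E' ⟶ Y'} (h' : 𝓔.IsConflation i' p') {ζ : Z ⟶ Z'} {γ : E ⟶ E'} {β : Y ⟶ Y'}
    (h₁ : i ≫ γ = ζ ≫ i') (h₂ : p ≫ β = γ ≫ p') {X X' : C} {α : X ⟶ X'}
    {ξ : 𝓔.YonedaExtension X n Z} {ξ' : 𝓔.YonedaExtension X' n Z'} (H : HasMor α ξ ξ' ζ) :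
    Ext.push α (ξ.spliceRight h) = Ext.pull β (ξ'.spliceRight h') := by
  cases n with
  | zero =>
    obtain _ | _ | _ := ξ
    obtain _ | _ | _ := ξ'
    simp only [HasMor] at H
    have : HasMor ζ (.single i p h) (.single i' p' h') β := ⟨γ, h₁, h₂⟩
    simp only [YonedaExtension.spliceRight]
    rw [Ext.push_push, H, ← Ext.push_push, Ext.push_mk_eq_pull_mk this, Ext.push_pull]
  | succ n => exact Ext.push_mk_eq_pull_mk ⟨ζ, γ, h₁, h₂, H⟩

end YonedaExtension

namespace Ext

variable {n : ℕ}

/-- The connecting map `Extⁿ(Z, X) → Extⁿ⁺¹(Y, X)` of a conflation `Z ⟶ E ⟶ Y`. -/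
noncomputable def spliceRight {Z E Y : C} {i : Z ⟶ E} {p : E ⟶ Y} (h : 𝓔.IsConflation i p) {X : C} :
    𝓔.Ext n Z X → 𝓔.Ext (n + 1) Y X :=
  Quot.lift (fun ξ => ξ.spliceRight h) fun ξ ξ' H => by
    have := H.spliceRight h h (γ := 𝟙 _) (β := 𝟙 _) (by simp) (by simp)
    simpa using this

section

variable {Z E Y : C} {i : Z ⟶ E} {p : E ⟶ Y} (h : 𝓔.IsConflation i p)

lemma spliceRight_mk_hom {X : C} (f : Z ⟶ X) :
    spliceRight h (mk (.hom f)) = push f (mk (.single i p h)) := rfl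

lemma spliceRight_mk_id : spliceRight h (mk (.hom (𝟙 Z))) = mk (.single i p h) := by
  rw [spliceRight_mk_hom, push_id]

lemma push_spliceRight {X X' : C} (α : X ⟶ X') (x : 𝓔.Ext n Z X) :
    push α (spliceRight h x) = spliceRight h (push α x) := by
  obtain ⟨ξ, rfl⟩ := exists_mk x
  obtain ⟨η, hη, H⟩ := exists_push_mk α ξ
  have := H.spliceRight h h (γ := 𝟙 _) (β := 𝟙 _) (by simp) (by simp)
  rw [hη]
  rw [pull_id] at this
  exact this

lemma spliceRight_pull {Z' E' Y' : C} {i' : Z' ⟶ E'}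
    {p' : E' ⟶ Y'} (h' : 𝓔.IsConflation i' p') {ζ : Z ⟶ Z'} {γ : E ⟶ E'} {β : Y ⟶ Y'}
    (h₁ : i ≫ γ = ζ ≫ i') (h₂ : p ≫ β = γ ≫ p') {X : C} (x : 𝓔.Ext n Z' X) :
    spliceRight h (pull ζ x) = pull β (spliceRight h' x) := by
  obtain ⟨ξ, rfl⟩ := exists_mk x
  obtain ⟨η, hη, H⟩ := exists_pull_mk ζ ξ
  have := H.spliceRight h h' h₁ h₂
  rw [hη]
  rw [push_id] at this
  exact this

lemma spliceRight_pull_of_refines {Z' E' : C} {i' : Z' ⟶ E'}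
    {p' : E' ⟶ Y} (h' : 𝓔.IsConflation i' p') {ζ : Z ⟶ Z'} {γ : E ⟶ E'}
    (h₁ : i ≫ γ = ζ ≫ i') (h₂ : p = γ ≫ p') {X : C} (x : 𝓔.Ext n Z' X) :
    spliceRight h (pull ζ x) = spliceRight h' x := by
  rw [spliceRight_pull h h' h₁ (β := 𝟙 _) (by simpa using h₂), pull_id]

end

lemma exists_spliceRight {X Y : C} (x : 𝓔.Ext (n + 1) Y X) :
    ∃ (Z E : C) (i : Z ⟶ E) (p : E ⟶ Y) (h : 𝓔.IsConflation i p) (x' : 𝓔.Ext n Z X),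
      x = spliceRight h x' := by
  obtain ⟨_ | ⟨i, p, h⟩ | ⟨i, p, h, ξ⟩, rfl⟩ := exists_mk x
  · exact ⟨_, _, i, p, h, mk (.hom (𝟙 _)), (spliceRight_mk_id h).symm⟩
  · exact ⟨_, _, i, p, h, mk ξ, rfl⟩

end Ext

namespace YonedaExtension

variable {X E Z : C} {i : X ⟶ E} {p : E ⟶ Z}

/-- The class of the extension obtained by splicing a conflation `X ⟶ E ⟶ Z` with an extension
by `Z`. -/
noncomputable def spliceLeft (h : 𝓔.IsConflation i p) :
    {n : ℕ} → {Y : C} → 𝓔.YonedaExtension Z n Y → 𝓔.Ext (n + 1) Y X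
  | _, _, .hom f => Ext.pull f (Ext.mk (.single i p h))
  | _, _, .single _ _ h' => Ext.spliceRight h' (Ext.mk (.single i p h))
  | _, _, .splice _ _ h' ξ => Ext.spliceRight h' (spliceLeft h ξ)

lemma HasMor.spliceLeft {n : ℕ} (h : 𝓔.IsConflation i p) {Y : C} (ξ : 𝓔.YonedaExtension Z n Y) :
    ∀ {X' E' Z' Y' : C} {i' : X' ⟶ E'} {p' : E' ⟶ Z'} (h' : 𝓔.IsConflation i' p') {α : X ⟶ X'}
    {γ : E ⟶ E'} {ζ : Z ⟶ Z'} (_ : i ≫ γ = α ≫ i') (_ : p ≫ ζ = γ ≫ p') {β : Y ⟶ Y'}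
    {ξ' : 𝓔.YonedaExtension Z' n Y'} (_ : HasMor ζ ξ ξ' β),
    Ext.push α (ξ.spliceLeft h) = Ext.pull β (ξ'.spliceLeft h') := by
  induction ξ with
  | hom f =>
    rintro _ _ _ _ _ _ h' α γ ζ h₁ h₂ β (_ | _ | _) H
    simp only [HasMor] at H
    have : HasMor α (.single i p h) (.single _ _ h') ζ := ⟨γ, h₁, h₂⟩
    simp only [YonedaExtension.spliceLeft]
    rw [Ext.push_pull, Ext.push_mk_eq_pull_mk this, Ext.pull_pull, Ext.pull_pull, H]
  | single i₁ p₁ k =>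
    rintro _ _ _ _ _ _ h' α γ ζ h₁ h₂ β (_ | ⟨i₂, p₂, k'⟩ | _) ⟨γ', h₁', h₂'⟩
    have : HasMor α (.single i p h) (.single _ _ h') ζ := ⟨γ, h₁, h₂⟩
    simp only [YonedaExtension.spliceLeft]
    rw [Ext.push_spliceRight, Ext.push_mk_eq_pull_mk this, Ext.spliceRight_pull k k' h₁' h₂']
  | splice i₁ p₁ k ξ ih =>
    rintro _ _ _ _ _ _ h' α γ ζ h₁ h₂ β (_ | _ | ⟨i₂, p₂, k', ξ'⟩) ⟨ζ', γ', h₁', h₂', H⟩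
    simp only [YonedaExtension.spliceLeft]
    rw [Ext.push_spliceRight, ih h' h₁ h₂ H, Ext.spliceRight_pull k k' h₁' h₂']

end YonedaExtension

namespace Ext

variable {n : ℕ}

/-- The connecting map `Extⁿ(Y, Z) → Extⁿ⁺¹(Y, X)` of a conflation `X ⟶ E ⟶ Z`. -/
noncomputable def spliceLeft {X E Z : C} {i : X ⟶ E} {p : E ⟶ Z} (h : 𝓔.IsConflation i p) {Y : C} :
    𝓔.Ext n Y Z → 𝓔.Ext (n + 1) Y X :=
  Quot.lift (fun ξ => ξ.spliceLeft h) fun ξ ξ' H => by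
    have := H.spliceLeft h _ h (α := 𝟙 _) (γ := 𝟙 _) (by simp) (by simp)
    simpa using this

variable {X E Z : C} {i : X ⟶ E} {p : E ⟶ Z} (h : 𝓔.IsConflation i p)

lemma spliceLeft_mk_hom {Y : C} (f : Y ⟶ Z) :
    spliceLeft h (mk (.hom f)) = pull f (mk (.single i p h)) := rfl

/-- Associativity of splicing. Only degree zero has content: a morphism between the two conflations
can be absorbed by push-out on the right or by pull-back on the left. -/
lemma spliceLeft_spliceRight {A B Y : C} {i' : A ⟶ B} {p' : B ⟶ Y} (h' : 𝓔.IsConflation i' p')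
    (x : 𝓔.Ext n A Z) : spliceLeft h (spliceRight h' x) = spliceRight h' (spliceLeft h x) := by
  obtain ⟨ξ, rfl⟩ := exists_mk x
  cases n with
  | zero =>
    obtain ⟨f⟩ | _ | _ := ξ
    rw [spliceRight_mk_hom, spliceLeft_mk_hom]
    obtain ⟨η, hη, H⟩ := exists_push_mk f (.single i' p' h')
    obtain _ | ⟨i₁, p₁, h₁⟩ | _ := η
    obtain ⟨γ, e₁, e₂⟩ := H
    rw [hη, spliceRight_pull_of_refines h' h₁ e₁ (by simpa using e₂)]
    rfl
  | succ n => rfl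

lemma spliceLeft_pull {Y Y' : C} (β : Y' ⟶ Y) (x : 𝓔.Ext n Y Z) :
    spliceLeft h (pull β x) = pull β (spliceLeft h x) := by
  obtain ⟨ξ, rfl⟩ := exists_mk x
  obtain ⟨η, hη, H⟩ := exists_pull_mk β ξ
  have := H.spliceLeft h _ h (α := 𝟙 _) (γ := 𝟙 _) (by simp) (by simp)
  rw [hη]
  rw [push_id] at this
  exact this

lemma push_spliceLeft {X' E' Z' : C} {i' : X' ⟶ E'} {p' : E' ⟶ Z'} (h' : 𝓔.IsConflation i' p')
    {α : X ⟶ X'} {γ : E ⟶ E'} {ζ : Z ⟶ Z'} (h₁ : i ≫ γ = α ≫ i') (h₂ : p ≫ ζ = γ ≫ p') {Y : C}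
    (x : 𝓔.Ext n Y Z) : push α (spliceLeft h x) = spliceLeft h' (push ζ x) := by
  obtain ⟨ξ, rfl⟩ := exists_mk x
  obtain ⟨η, hη, H⟩ := exists_push_mk ζ ξ
  have := H.spliceLeft h _ h' h₁ h₂
  rw [hη]
  rw [pull_id] at this
  exact this

end Ext

end Splice

end ExactStructure
end

/-! ### Vanishing of spliced classes and the long exact sequences -/

section
variable {C : Type u} [Category.{v} C] [Preadditive C] {𝓔 : ExactStructure C}

namespace ExactStructure

open YonedaExtension

variable [HasBinaryBiproducts C] [HasZeroObject C]

namespace Ext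

variable {n : ℕ}

lemma spliceRight_add {Z E Y : C} {i : Z ⟶ E} {p : E ⟶ Y} (h : 𝓔.IsConflation i p) {X : C}
    (x y : 𝓔.Ext n Z X) : spliceRight h (x + y) = spliceRight h x + spliceRight h y :=
  map_add_of_push (fun _ => spliceRight h) (fun α x => (push_spliceRight h α x).symm) x y

lemma spliceLeft_add {X E Z : C} {i : X ⟶ E} {p : E ⟶ Z} (h : 𝓔.IsConflation i p) {Y : C}
    (x y : 𝓔.Ext n Y Z) : spliceLeft h (x + y) = spliceLeft h x + spliceLeft h y :=
  map_add_of_pull (fun _ => spliceLeft h) (fun β x => spliceLeft_pull h β x) x y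

/-- `spliceRight` as a homomorphism of groups. -/
noncomputable def spliceRightHom {Z E Y : C} {i : Z ⟶ E} {p : E ⟶ Y} (h : 𝓔.IsConflation i p)
    (X : C) (n : ℕ) : 𝓔.Ext n Z X →+ 𝓔.Ext (n + 1) Y X :=
  AddMonoidHom.mk' (spliceRight h) (spliceRight_add h)

/-- `spliceLeft` as a homomorphism of groups. -/
noncomputable def spliceLeftHom {X E Z : C} {i : X ⟶ E} {p : E ⟶ Z} (h : 𝓔.IsConflation i p)
    (Y : C) (n : ℕ) : 𝓔.Ext n Y Z →+ 𝓔.Ext (n + 1) Y X :=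
  AddMonoidHom.mk' (spliceLeft h) (spliceLeft_add h)

/-- A positive degree class vanishes on a suitable deflation. -/
lemma exists_pull_eq_zero {X Y : C} (x : 𝓔.Ext (n + 1) Y X) :
    ∃ (A E : C) (i : A ⟶ E) (p : E ⟶ Y), 𝓔.IsConflation i p ∧ pull p x = 0 := by
  obtain ⟨_ | ⟨i, p, h⟩ | ⟨i, p, h, ξ⟩, rfl⟩ := exists_mk x
  -- The right-most conflation itself serves: it splits after pull-back along its own deflation.
  · exact ⟨_, _, i, p, h, pull_mk_eq ⟨biprod.desc i (𝟙 _), by simp, by ext <;> simp [h.zero]⟩⟩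
  · exact ⟨_, _, i, p, h, pull_mk_eq
      ⟨0, 𝟙 _, by simp, by simp, HasMor.from_trivial ξ⟩⟩

end Ext

namespace YonedaExtension

/-- The extension obtained by removing the right-most conflation becomes trivial after pulling it
back to some refinement of that conflation. -/
def VanishesOnRefinement {X : C} {n : ℕ} {Y : C} : 𝓔.YonedaExtension X (n + 2) Y → Prop
  | .splice (Z := Z) (E := E) i p _ ξ =>
    ∃ (Z' E' : C) (i' : Z' ⟶ E') (p' : E' ⟶ Y) (ζ : Z' ⟶ Z) (γ : E' ⟶ E),
      𝓔.IsConflation i' p' ∧ i' ≫ γ = ζ ≫ i ∧ p' = γ ≫ p ∧ Ext.pull ζ (Ext.mk ξ) = 0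

end YonedaExtension

namespace Ext

variable {n : ℕ}

/-- If a class vanishes on a refinement of a conflation, then its restriction along any morphism
of conflations vanishes on a refinement, which may be chosen with a deflation in the middle. -/
lemma exists_refinement {X Y Z₁ E₁ Z' E' Z E : C} {i₁ : Z₁ ⟶ E₁} {p₁ : E₁ ⟶ Y}
    (h₁ : 𝓔.IsConflation i₁ p₁) (x : 𝓔.Ext (n + 1) Z₁ X) {i' : Z' ⟶ E'} {p' : E' ⟶ Y}
    (h' : 𝓔.IsConflation i' p') {ζ' : Z' ⟶ Z₁} {γ' : E' ⟶ E₁} (e₁ : i' ≫ γ' = ζ' ≫ i₁)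
    (e₂ : p' = γ' ≫ p₁) (hx : pull ζ' x = 0) {i : Z ⟶ E} {p : E ⟶ Y}
    (h : 𝓔.IsConflation i p) {z : Z ⟶ Z₁} {γ : E ⟶ E₁} (e₃ : i ≫ γ = z ≫ i₁)
    (e₄ : p = γ ≫ p₁) :
    ∃ (Z'' E'' : C) (i'' : Z'' ⟶ E'') (p'' : E'' ⟶ Y) (ζ : Z'' ⟶ Z) (g : E'' ⟶ E),
      𝓔.IsConflation i'' p'' ∧ i'' ≫ g = ζ ≫ i ∧ p'' = g ≫ p ∧ pull ζ (pull z x) = 0 ∧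
        IsDeflationFor 𝓔.conflation g := by
  have := h₁.mono
  -- G is the fibre product of E' and E over Y. Its two morphisms to E₁ agree over Y, so they differ
  -- by some s : G ⟶ Z₁.
  obtain ⟨G, f', j, q, sq, hj, hjf⟩ := h'.exists_pullback p
  obtain ⟨s, hs⟩ := h₁.exists_lift (q ≫ γ - f' ≫ γ') (by
    rw [Preadditive.sub_comp, Category.assoc, Category.assoc, ← e₂, ← e₄, sq.w, sub_self])
  -- The error term `pull s x` has positive degree, so a further deflation r kills it; the
  -- refinement sought is G' ⟶ G ⟶ E ⟶ Y.
  obtain ⟨A, G', a, r, ha, hr⟩ := exists_pull_eq_zero (pull s x)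
  obtain ⟨K₁, k₁, hk₁⟩ := ha.exists_comp hj
  obtain ⟨K, k, hk⟩ := hk₁.exists_comp h
  obtain ⟨ζ, hζ⟩ := h.exists_lift (k ≫ r ≫ q) (by simpa using hk.zero)
  obtain ⟨b, hb⟩ := h'.exists_lift (k ≫ r ≫ f') (by
    simp only [Category.assoc, sq.w]; simpa using hk.zero)
  refine ⟨K, G', k, _, ζ, r ≫ q, hk, hζ.symm, rfl, ?_, hk₁.deflation⟩
  -- On the new kernel, the restriction of x is a sum of two terms: one dies by `hx`, the other by
  -- the choice of r.
  have e : ζ ≫ z = b ≫ ζ' + k ≫ r ≫ s := by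
    rw [← cancel_mono i₁, Category.assoc, ← e₃, reassoc_of% hζ, Preadditive.add_comp,
      Category.assoc, ← e₁, reassoc_of% hb, Category.assoc, Category.assoc, hs]
    simp
  rw [pull_pull, e, ← pull_add_pull, ← pull_pull, hx, ← pull_pull k, ← pull_pull r, hr]
  simp [pull_zero]

/-- Refinements of the source compose to refinements of the target. The converse has no direct map
to use and needs the fibre product of `exists_refinement`. Invariance lets the predicate descend to
Ext classes. -/
lemma vanishesOnRefinement_iff_of_hasMor {X Y : C} {ξ η : 𝓔.YonedaExtension X (n + 2) Y}
    (H : HasMor (𝟙 X) ξ η (𝟙 Y)) : ξ.VanishesOnRefinement ↔ η.VanishesOnRefinement := by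
  obtain _ | _ | ⟨i, p, h, ξ⟩ := ξ
  obtain _ | _ | ⟨i₁, p₁, h₁, ξ₁⟩ := η
  obtain ⟨z, γ, e₁, e₂, H⟩ := H
  have e : pull z (mk ξ₁) = mk ξ := pull_mk_eq H
  constructor
  · rintro ⟨Z', E', i', p', ζ', γ', h', e₁', e₂', hx⟩
    refine ⟨Z', E', i', p', ζ' ≫ z, γ' ≫ γ, h', ?_, ?_, ?_⟩
    · rw [reassoc_of% e₁', e₁, Category.assoc]
    · rw [e₂', Category.assoc, ← e₂, Category.comp_id]
    · rw [← pull_pull, e, hx]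
  · rintro ⟨Z', E', i', p', ζ', γ', h', e₁', e₂', hx⟩
    obtain ⟨Z'', E'', i'', p'', ζ, g, h'', e₁'', e₂'', hx', -⟩ :=
      exists_refinement h₁ _ h' e₁' e₂' hx h e₁ (by simpa using e₂)
    exact ⟨Z'', E'', i'', p'', ζ, g, h'', e₁'', e₂'', by rw [← e, hx']⟩

/-- A spliced class vanishes only if one of the factors vanishes on a refinement of the
conflation. -/
lemma exists_refinement_of_spliceRight_eq_zero {X Y Z E : C} {i : Z ⟶ E} {p : E ⟶ Y}
    (h : 𝓔.IsConflation i p) (x : 𝓔.Ext (n + 1) Z X) (hx : spliceRight h x = 0) :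
    ∃ (Z' E' : C) (i' : Z' ⟶ E') (p' : E' ⟶ Y) (ζ : Z' ⟶ Z) (g : E' ⟶ E),
      𝓔.IsConflation i' p' ∧ i' ≫ g = ζ ≫ i ∧ p' = g ≫ p ∧ pull ζ x = 0 ∧
        IsDeflationFor 𝓔.conflation g := by
  obtain ⟨ξ, rfl⟩ := exists_mk x
  -- The trivial extension needs no refinement, as its part left of the last conflation is already
  -- the zero class.
  have h₀ : (trivial 𝓔 X (n + 2) Y).VanishesOnRefinement :=
    ⟨_, _, 0, 𝟙 Y, 𝟙 _, 𝟙 _, 𝓔.isConflation_zero_id (isZero_zero C) Y, by simp, by simp,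
      pull_zero _⟩
  have h₁ : (splice i p h ξ).VanishesOnRefinement = (trivial 𝓔 X (n + 2) Y).VanishesOnRefinement :=
    congrArg (Quot.lift VanishesOnRefinement fun _ _ H =>
      propext (vanishesOnRefinement_iff_of_hasMor H)) hx
  rw [← h₁] at h₀
  obtain ⟨Z', E', i', p', ζ', γ', h', e₁', e₂', hx⟩ := h₀
  -- Refining once more, relative to the conflation itself, turns the middle morphism into a
  -- deflation; `contravariant_exact` needs this.
  obtain ⟨Z'', E'', i'', p'', ζ, g, h'', e₁'', e₂'', hx', hg⟩ :=
    exists_refinement h _ h' e₁' e₂' hx h (z := 𝟙 _) (γ := 𝟙 _) (by simp) (by simp)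
  exact ⟨Z'', E'', i'', p'', ζ, g, h'', e₁'', e₂'', by simpa using hx', hg⟩

lemma exists_retraction_of_mk_eq_zero {X E Y : C} {i : X ⟶ E} {p : E ⟶ Y}
    (h : 𝓔.IsConflation i p) (hx : mk (.single i p h) = 0) : ∃ r : E ⟶ X, i ≫ r = 𝟙 X :=
  (isSplit_iff_of_mk_eq (η := trivial 𝓔 X 1 Y) hx).2 ⟨biprod.fst, by simp⟩

/-- If the push-out of a conflation along `f` splits, then `f` extends along the inflation. -/
lemma exists_extension {Z E Y : C} {i : Z ⟶ E} {p : E ⟶ Y} (h : 𝓔.IsConflation i p) {X : C}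
    (f : Z ⟶ X) (hf : push f (mk (.single i p h)) = 0) : ∃ g : E ⟶ X, i ≫ g = f := by
  obtain ⟨η, hη, H⟩ := exists_push_mk f (.single i p h)
  obtain _ | ⟨i', p', h'⟩ | _ := η
  obtain ⟨γ, e₁, e₂⟩ := H
  obtain ⟨r, hr⟩ := exists_retraction_of_mk_eq_zero h' (hη ▸ hf)
  exact ⟨γ ≫ r, by rw [reassoc_of% e₁, hr, Category.comp_id]⟩

/-- If the pull-back of a conflation along `f` splits, then `f` lifts along the deflation. -/
lemma exists_lift {X E Z : C} {i : X ⟶ E} {p : E ⟶ Z} (h : 𝓔.IsConflation i p) {Y : C}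
    (f : Y ⟶ Z) (hf : pull f (mk (.single i p h)) = 0) : ∃ g : Y ⟶ E, g ≫ p = f := by
  obtain ⟨η, hη, H⟩ := exists_pull_mk f (.single i p h)
  obtain _ | ⟨i', p', h'⟩ | _ := η
  obtain ⟨γ, e₁, e₂⟩ := H
  obtain ⟨r, hr⟩ := exists_retraction_of_mk_eq_zero h' (hη ▸ hf)
  obtain ⟨s, hs⟩ := h'.exists_section hr
  exact ⟨s ≫ γ, by rw [Category.assoc, ← e₂, reassoc_of% hs]⟩

section Covariant

variable {X E Z : C} {i : X ⟶ E} {p : E ⟶ Z} (h : 𝓔.IsConflation i p)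

/-- Exactness of `Extⁿ(Y, Z) → Extⁿ⁺¹(Y, X) → Extⁿ⁺¹(Y, E)`. -/
lemma exists_spliceLeft {Y : C} (x : 𝓔.Ext (n + 1) Y X) (hx : push i x = 0) :
    ∃ x' : 𝓔.Ext n Y Z, spliceLeft h x' = x := by
  induction n generalizing Y with
  | zero =>
    obtain ⟨_ | ⟨j, q, k⟩ | _, rfl⟩ := exists_mk x
    obtain ⟨γ, hγ⟩ := exists_extension k i hx
    obtain ⟨f, hf⟩ := k.exists_desc (γ ≫ p) (by rw [reassoc_of% hγ, h.zero])
    exact ⟨mk (.hom f), by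
      rw [spliceLeft_mk_hom]; exact pull_mk_eq ⟨γ, by simpa using hγ, hf⟩⟩
  | succ n ih =>
    obtain ⟨W, F, j, q, k, x₁, rfl⟩ := exists_spliceRight x
    -- The hypothesis moves to the left factor x₁ on a refinement; the induction hypothesis applies
    -- there, and splicing back along the refinement recovers x.
    rw [push_spliceRight] at hx
    obtain ⟨W', F', j', q', ζ, g, k', e₁, e₂, hx', -⟩ :=
      exists_refinement_of_spliceRight_eq_zero k _ hx
    rw [← push_pull] at hx'
    obtain ⟨x', hx''⟩ := ih _ hx'
    exact ⟨spliceRight k' x', by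
      rw [spliceLeft_spliceRight, hx'', spliceRight_pull_of_refines k' k e₁ e₂]⟩

/-- Exactness of `Extⁿ(Y, E) → Extⁿ(Y, Z) → Extⁿ⁺¹(Y, X)`. -/
lemma exists_push_eq {Y : C} (x : 𝓔.Ext n Y Z) (hx : spliceLeft h x = 0) :
    ∃ m : 𝓔.Ext n Y E, push p m = x := by
  induction n generalizing Y with
  | zero =>
    obtain ⟨f, rfl⟩ := exists_mk_hom x
    obtain ⟨g, rfl⟩ := exists_lift h f hx
    exact ⟨mk (.hom g), push_mk_hom _ _⟩
  | succ n ih =>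
    obtain ⟨W, F, j, q, k, x₁, rfl⟩ := exists_spliceRight x
    rw [spliceLeft_spliceRight] at hx
    obtain ⟨W', F', j', q', ζ, g, k', e₁, e₂, hx', -⟩ :=
      exists_refinement_of_spliceRight_eq_zero k _ hx
    rw [← spliceLeft_pull] at hx'
    obtain ⟨m, hm⟩ := ih _ hx'
    exact ⟨spliceRight k' m, by
      rw [push_spliceRight, hm, spliceRight_pull_of_refines k' k e₁ e₂]⟩

end Covariant

/-- The conflation maps to the split conflation E ⟶ E ⊞ Y ⟶ Y with i on the left and zero on the
right, so the class is pulled back along zero. -/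
lemma spliceRight_pull_self {Z E Y : C} {i : Z ⟶ E} {p : E ⟶ Y} (h : 𝓔.IsConflation i p)
    {X : C} (m : 𝓔.Ext n E X) : spliceRight h (pull i m) = 0 := by
  rw [spliceRight_pull h (𝓔.isConflation_split E Y) (γ := biprod.inl) (β := 0) rfl (by simp),
    pull_zero_mor]

/-- Exactness of the contravariant long exact sequence at the sub and at the quotient object of a
conflation. -/
lemma contravariant_exact (n : ℕ) :
    (∀ {Z E Y : C} {i : Z ⟶ E} {p : E ⟶ Y} (h : 𝓔.IsConflation i p) {X : C}
      (x : 𝓔.Ext n Z X), spliceRight h x = 0 → ∃ m : 𝓔.Ext n E X, pull i m = x) ∧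
    ∀ {Z E Y : C} {i : Z ⟶ E} {p : E ⟶ Y} (h : 𝓔.IsConflation i p) {X : C}
      (x : 𝓔.Ext (n + 1) Y X), pull p x = 0 → ∃ x' : 𝓔.Ext n Z X, spliceRight h x' = x := by
  induction n with
  | zero =>
    constructor
    · intro Z E Y i p h X x hx
      obtain ⟨f, rfl⟩ := exists_mk_hom x
      obtain ⟨g, rfl⟩ := exists_extension h f hx
      exact ⟨mk (.hom g), pull_mk_hom _ _⟩
    · intro Z E Y i p h X x hx
      obtain ⟨_ | ⟨j, q, k⟩ | _, rfl⟩ := exists_mk x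
      obtain ⟨γ, hγ⟩ := exists_lift k p hx
      obtain ⟨f, hf⟩ := k.exists_lift (i ≫ γ) (by rw [Category.assoc, hγ, h.zero])
      exact ⟨mk (.hom f), by
        rw [spliceRight_mk_hom]; exact push_mk_eq ⟨γ, hf.symm, by simpa using hγ.symm⟩⟩
  | succ n ih =>
    -- The two statements feed each other: exactness at Z in degree n + 1 uses exactness at the
    -- quotient one step lower, and in turn gives the next exactness at the quotient.
    have H : ∀ {Z E Y : C} {i : Z ⟶ E} {p : E ⟶ Y} (h : 𝓔.IsConflation i p) {X : C}
        (x : 𝓔.Ext (n + 1) Z X), spliceRight h x = 0 → ∃ m : 𝓔.Ext (n + 1) E X, pull i m = x := by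
      intro Z E Y i p h X x hx
      obtain ⟨Z', E', i', p', ζ, g, h', e₁, e₂, hx', K, j, w, hj⟩ :=
        exists_refinement_of_spliceRight_eq_zero h _ hx
      have hj : 𝓔.IsConflation j g := ⟨w, hj⟩
      -- The deflation g with kernel K is restricted along i to a deflation q : B ⟶ Z with the same
      -- kernel. It factors through ζ, so it kills x, which is thus spliced from a class on K;
      -- splicing that class with `hj` extends x to E.
      obtain ⟨B, f, j', q, sq, hj', hjf⟩ := hj.exists_pullback i
      obtain ⟨b, hb⟩ := h'.exists_lift f (by rw [e₂, reassoc_of% sq.w, h.zero, comp_zero])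
      have := h.mono
      have hbq : b ≫ ζ = q := by
        rw [← cancel_mono i, Category.assoc, ← e₁, reassoc_of% hb, sq.w]
      obtain ⟨x', rfl⟩ := ih.2 hj' x (by rw [← hbq, ← pull_pull, hx', pull_zero])
      refine ⟨spliceRight hj x', ?_⟩
      rw [← spliceRight_pull hj' hj (ζ := 𝟙 _) (by simpa using hjf) sq.w.symm, pull_id]
    refine ⟨H, ?_⟩
    · intro Z E Y i p h X x hx
      obtain ⟨W, F, j, q, k, x₁, rfl⟩ := exists_spliceRight x
      obtain ⟨G, f, w, q', sq, k', hwf⟩ := k.exists_pullback p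
      have e : spliceRight k' x₁ = 0 := by
        rw [← hx, ← spliceRight_pull k' k (ζ := 𝟙 _) (by simpa using hwf) sq.w.symm, pull_id]
      obtain ⟨m, rfl⟩ := H k' x₁ e
      -- K ⟶ G ⟶ Y, with G the fibre product of F and E over Y, refines both conflations `k` and
      -- `h`, so classes spliced along either can be compared on it.
      obtain ⟨K, κ, hκ⟩ := k'.exists_comp h
      have hκ₀ : κ ≫ q' ≫ p = 0 := hκ.zero
      obtain ⟨a, ha⟩ := k.exists_lift (κ ≫ f) (by rw [Category.assoc, sq.w, hκ₀])
      obtain ⟨b, hb⟩ := h.exists_lift (κ ≫ q') (by rw [Category.assoc, hκ₀])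
      let z : Z ⟶ G := sq.lift 0 i (by rw [h.zero, zero_comp])
      -- The κ-term extends to G, so splicing kills it by `spliceRight_pull_self`; the remaining
      -- term comes from Z.
      have hz : a ≫ w = κ + b ≫ (-z) := by
        refine sq.hom_ext ?_ ?_
        · simp [z, hwf, ha]
        · simp [z, k'.zero, hb]
      refine ⟨pull (-z) m, ?_⟩
      rw [← spliceRight_pull_of_refines hκ k ha.symm sq.w.symm, pull_pull, hz, ← pull_add_pull,
        spliceRight_add, spliceRight_pull_self, zero_add, ← pull_pull,
        spliceRight_pull_of_refines hκ h hb.symm rfl]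

end Ext
end ExactStructure
end

/-! ### Objectwise exactness for additive functors -/

namespace AddModule

section
variable {A : Type u} [Category.{v} A] [Preadditive A]

/-- The component of a morphism of additive functors as a group homomorphism. -/
def eval {F G : A ⥤+ AddCommGrpCat.{v}} (f : F ⟶ G) (a : A) : F.obj.obj a →+ G.obj.obj a :=
  (f.hom.app a).hom

lemma hom_ext {F G : A ⥤+ AddCommGrpCat.{v}} {f g : F ⟶ G}
    (h : ∀ a x, eval f a x = eval g a x) : f = g := by
  ext a x
  exact h a x

lemma eval_comp {F G H : A ⥤+ AddCommGrpCat.{v}} (f : F ⟶ G) (g : G ⟶ H) (a : A)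
    (x : F.obj.obj a) : eval (f ≫ g) a x = eval g a (eval f a x) := rfl

lemma eval_naturality {F G : A ⥤+ AddCommGrpCat.{v}} (f : F ⟶ G) {a b : A} (u : a ⟶ b)
    (x : F.obj.obj a) : eval f b ((F.obj.map u).hom x) = (G.obj.map u).hom (eval f a x) :=
  congr($(f.hom.naturality u) x)

/-- The inclusion into all functors preserves epimorphisms, and there they are tested objectwise. -/
lemma eval_surjective_of_epi {F G : A ⥤+ AddCommGrpCat.{v}} (f : F ⟶ G) [Epi f] (a : A) :
    Function.Surjective (eval f a) := by
  have := (additiveFunctor A AddCommGrpCat.{v}).preservesEpimorphisms_ι_of_isNormalMonoCategory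
  have h : Epi ((additiveFunctor A AddCommGrpCat.{v}).ι.map f) := inferInstance
  have h' : Epi f.hom := h
  have := (NatTrans.epi_iff_epi_app f.hom).1 h' a
  exact (AddCommGrpCat.epi_iff_surjective _).1 this

lemma epi_of_eval_surjective {F G : A ⥤+ AddCommGrpCat.{v}} (f : F ⟶ G)
    (h : ∀ a : A, Function.Surjective (eval f a)) : Epi f := by
  refine ⟨fun g g' e => hom_ext fun a y => ?_⟩
  obtain ⟨x, rfl⟩ := h a y
  rw [← eval_comp, e, eval_comp]

lemma mono_of_eval_injective {F G : A ⥤+ AddCommGrpCat.{v}} (f : F ⟶ G)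
    (h : ∀ a : A, Function.Injective (eval f a)) : Mono f :=
  ⟨fun g g' e => hom_ext fun a y => h a (by rw [← eval_comp, e, eval_comp])⟩

/-- A short complex of additive functors that is objectwise short exact is short exact. -/
lemma shortExact_of_eval {S : ShortComplex (A ⥤+ AddCommGrpCat.{v})}
    (hf : ∀ a : A, Function.Injective (eval S.f a))
    (hfg : ∀ (a : A) (y : S.X₂.obj.obj a), eval S.g a y = 0 → ∃ x, eval S.f a x = y)
    (hg : ∀ a : A, Function.Surjective (eval S.g a)) : S.ShortExact := by
  have := mono_of_eval_injective S.f hf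
  have := epi_of_eval_surjective S.g hg
  refine { exact := ?_ }
  refine S.exact_of_f_is_kernel (KernelFork.IsLimit.ofι' _ _ fun {T} k hk => ?_)
  have hk' : ∀ a (t : T.obj.obj a), eval S.g a (eval k a t) = 0 := fun a t => by
    rw [← eval_comp, hk]; rfl
  -- The lift to the kernel is chosen elementwise; injectivity of the components makes it additive
  -- and natural.
  choose l hl using fun a t => hfg a _ (hk' a t)
  refine ⟨⟨{ app := fun a => AddCommGrpCat.ofHom (AddMonoidHom.mk' (l a) fun x y => hf a ?_)
             naturality := fun a b u => ?_ }⟩, ?_⟩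
  · rw [hl, map_add, map_add, hl, hl]
  · ext t
    refine hf b ?_
    change eval S.f b (l b ((T.obj.map u).hom t)) = eval S.f b ((S.X₁.obj.map u).hom (l a t))
    rw [hl, eval_naturality, eval_naturality, hl]
  · exact hom_ext fun a t => hl a t

end
end AddModule

/-! ### Ψ and Φ: Yoneda, full faithfulness, exactness, projectives -/

section
variable {C : Type u} [Category.{v} C] [Preadditive C] {𝓔 : ExactStructure C}
  (M : ObjectProperty C)

/-- The morphisms to objects of `M` extend along the first morphism of a pair. -/
def ExtendsTo {A B Z : C} (i : A ⟶ B) (_ : B ⟶ Z) : Prop :=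
  ∀ N : C, M N → Function.Surjective fun g : B ⟶ N => i ≫ g

/-- The morphisms from objects of `M` lift along the second morphism of a pair. -/
def LiftsFrom {A B Z : C} (_ : A ⟶ B) (p : B ⟶ Z) : Prop :=
  ∀ N : C, M N → Function.Surjective fun g : N ⟶ B => g ≫ p

open Opposite

variable {M}

/-- The component of a morphism `Ψ X ⟶ Ψ Y` at an object of `M`. -/
def psiEval {X Y N : C} (hN : M N) (α : (psi M).obj (op X) ⟶ (psi M).obj (op Y)) :
    (X ⟶ N) →+ (Y ⟶ N) := AddModule.eval α ⟨N, hN⟩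

lemma psi_hom_ext {X Y : C} {α β : (psi M).obj (op X) ⟶ (psi M).obj (op Y)}
    (h : ∀ (N : C) (hN : M N) (g : X ⟶ N), psiEval hN α g = psiEval hN β g) : α = β :=
  AddModule.hom_ext fun N g => h N.obj N.property g

lemma psiEval_map {X Y N : C} (hN : M N) (f : Y ⟶ X) (g : X ⟶ N) :
    psiEval hN ((psi M).map f.op) g = f ≫ g := rfl

lemma psiEval_comp {X Y N N' : C} (hN : M N) (hN' : M N')
    (α : (psi M).obj (op X) ⟶ (psi M).obj (op Y)) (g : X ⟶ N) (u : N ⟶ N') :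
    psiEval hN' α (g ≫ u) = psiEval hN α g ≫ u :=
  AddModule.eval_naturality α (a := ⟨N, hN⟩) (b := ⟨N', hN'⟩) (M.homMk u) g

/-- The component of a morphism `Φ X ⟶ Φ Y` at an object of `M`. -/
def phiEval {X Y N : C} (hN : M N) (α : (phi M).obj X ⟶ (phi M).obj Y) :
    (N ⟶ X) →+ (N ⟶ Y) := AddModule.eval α (op ⟨N, hN⟩)

lemma phi_hom_ext {X Y : C} {α β : (phi M).obj X ⟶ (phi M).obj Y}
    (h : ∀ (N : C) (hN : M N) (g : N ⟶ X), phiEval hN α g = phiEval hN β g) : α = β :=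
  AddModule.hom_ext fun N g => h N.unop.obj N.unop.property g

lemma phiEval_map {X Y N : C} (hN : M N) (f : X ⟶ Y) (g : N ⟶ X) :
    phiEval hN ((phi M).map f) g = g ≫ f := rfl

lemma phiEval_comp {X Y N N' : C} (hN : M N) (hN' : M N')
    (α : (phi M).obj X ⟶ (phi M).obj Y) (g : N ⟶ X) (u : N' ⟶ N) :
    phiEval hN' α (u ≫ g) = u ≫ phiEval hN α g :=
  AddModule.eval_naturality α (a := op ⟨N, hN⟩) (b := op ⟨N', hN'⟩)
    (Quiver.Hom.op (ObjectProperty.homMk u)) g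

lemma psi_map_surjective_of_prop {N Y : C} (hN : M N)
    (α : (psi M).obj (op N) ⟶ (psi M).obj (op Y)) : ∃ f : Y ⟶ N, (psi M).map f.op = α := by
  refine ⟨psiEval hN α (𝟙 N), psi_hom_ext fun N' hN' g => ?_⟩
  rw [psiEval_map, ← psiEval_comp hN hN', Category.id_comp]

lemma phi_map_surjective_of_prop {N Y : C} (hN : M N)
    (α : (phi M).obj N ⟶ (phi M).obj Y) : ∃ f : N ⟶ Y, (phi M).map f = α := by
  refine ⟨phiEval hN α (𝟙 N), phi_hom_ext fun N' hN' g => ?_⟩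
  rw [phiEval_map, ← phiEval_comp hN hN', Category.comp_id]

/-- The preimage of α is the lift of α(i) : Y ⟶ M₀ through X. The second conflation serves to show
α(i) ≫ p = 0: Z need not lie in M, but it embeds in M₁, where naturality of α applies to p ≫ i'.
Extension of morphisms from X to M₀ makes α determined by α(i). -/
lemma psi_map_bijective {X Y M₀ Z M₁ Z' : C} {i : X ⟶ M₀} {p : M₀ ⟶ Z} (h : 𝓔.IsConflation i p)
    {i' : Z ⟶ M₁} {p' : M₁ ⟶ Z'} (h' : 𝓔.IsConflation i' p') (h₀ : M M₀) (h₁ : M M₁)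
    (H : ExtendsTo M i p) :
    Function.Bijective fun f : Y ⟶ X => (psi M).map f.op := by
  have := h.mono
  have := h'.mono
  constructor
  · intro f f' e
    have e' := congrArg (fun t => psiEval h₀ t i) e
    exact (cancel_mono i).1 e'
  · intro α
    have hg : psiEval h₀ α i ≫ p = 0 := by
      rw [← cancel_mono i', zero_comp, Category.assoc, ← psiEval_comp h₀ h₁ α,
        reassoc_of% h.zero, zero_comp, map_zero]
    obtain ⟨f, hf⟩ := h.exists_lift _ hg
    refine ⟨f, psi_hom_ext fun N hN k => ?_⟩
    obtain ⟨k, rfl⟩ := H _ hN k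
    dsimp only
    rw [psiEval_map, psiEval_comp h₀ hN, reassoc_of% hf]

lemma phi_map_bijective {X Y M₀ Z M₁ Z' : C} {i : Z ⟶ M₀} {p : M₀ ⟶ Y} (h : 𝓔.IsConflation i p)
    {i' : Z' ⟶ M₁} {p' : M₁ ⟶ Z} (h' : 𝓔.IsConflation i' p') (h₀ : M M₀) (h₁ : M M₁)
    (H : LiftsFrom M i p) :
    Function.Bijective fun f : Y ⟶ X => (phi M).map f := by
  have := h.epi
  have := h'.epi
  constructor
  · intro f f' e
    have e' := congrArg (fun t => phiEval h₀ t p) e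
    exact (cancel_epi p).1 e'
  · intro α
    have hg : i ≫ phiEval h₀ α p = 0 := by
      rw [← cancel_epi p', comp_zero, ← Category.assoc, ← phiEval_comp h₀ h₁ α,
        Category.assoc, h.zero, comp_zero, map_zero]
    obtain ⟨f, hf⟩ := h.exists_desc _ hg
    refine ⟨f, phi_hom_ext fun N hN k => ?_⟩
    obtain ⟨k, rfl⟩ := H _ hN k
    dsimp only
    rw [phiEval_map, phiEval_comp h₀ hN, Category.assoc, hf]

/-- Cokernels make Hom(-, N) left exact on any conflation, so only surjectivity at the right end is
at stake. -/
lemma shortExact_psi_iff {A B Z : C} {i : A ⟶ B} {p : B ⟶ Z} (h : 𝓔.IsConflation i p) :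
    ((ShortComplex.mk i p h.zero).op.map (psi M)).ShortExact ↔ ExtendsTo M i p := by
  constructor
  · intro hS N hN
    have := hS.epi_g
    exact AddModule.eval_surjective_of_epi
      (((ShortComplex.mk i p h.zero).op.map (psi M)).g) ⟨N, hN⟩
  · intro H
    have := h.epi
    refine AddModule.shortExact_of_eval ?_ ?_ ?_
    · exact fun N g g' e => (cancel_epi p).1 e
    · exact fun N g e => h.exists_desc g e
    · exact fun N => H N.obj N.property

lemma shortExact_phi_iff {A B Z : C} {i : A ⟶ B} {p : B ⟶ Z} (h : 𝓔.IsConflation i p) :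
    ((ShortComplex.mk i p h.zero).map (phi M)).ShortExact ↔ LiftsFrom M i p := by
  constructor
  · intro hS N hN
    have := hS.epi_g
    exact AddModule.eval_surjective_of_epi (((ShortComplex.mk i p h.zero).map (phi M)).g)
      (op ⟨N, hN⟩)
  · intro H
    have := h.mono
    refine AddModule.shortExact_of_eval ?_ ?_ ?_
    · exact fun N g g' e => (cancel_mono i).1 e
    · exact fun N g e => h.exists_lift g e
    · exact fun N => H N.unop.obj N.unop.property

/-- The morphism `Ψ N ⟶ F` given by an element of `F N`, for `N` in `M`. -/
def psiDesc {N : C} (hN : M N) {F : M.FullSubcategory ⥤+ AddCommGrpCat.{v}}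
    (x : F.obj.obj ⟨N, hN⟩) : (psi M).obj (op N) ⟶ F :=
  ⟨{ app := fun N' => AddCommGrpCat.ofHom (AddMonoidHom.mk'
      (fun g : N ⟶ N'.obj => (F.obj.map (X := ⟨N, hN⟩) (ObjectProperty.homMk g)).hom x)
      fun g g' => by
        have e : (ObjectProperty.homMk (g + g') : (⟨N, hN⟩ : M.FullSubcategory) ⟶ N') =
          ObjectProperty.homMk g + ObjectProperty.homMk g' := rfl
        rw [e, F.obj.map_add]
        rfl)
     naturality := fun N₁ N₂ u => by
      ext (g : N ⟶ N₁.obj)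
      have e : (ObjectProperty.homMk (g ≫ u.hom) : (⟨N, hN⟩ : M.FullSubcategory) ⟶ N₂) =
          ObjectProperty.homMk g ≫ u := rfl
      change (F.obj.map (X := ⟨N, hN⟩) (ObjectProperty.homMk (g ≫ u.hom))).hom x = _
      rw [e, F.obj.map_comp]
      rfl }⟩

/-- The morphism `Φ N ⟶ F` given by an element of `F N`, for `N` in `M`. -/
def phiDesc {N : C} (hN : M N) {F : M.FullSubcategoryᵒᵖ ⥤+ AddCommGrpCat.{v}}
    (x : F.obj.obj (op ⟨N, hN⟩)) : (phi M).obj N ⟶ F :=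
  ⟨{ app := fun N' => AddCommGrpCat.ofHom (AddMonoidHom.mk'
      (fun g : N'.unop.obj ⟶ N =>
        (F.obj.map (X := op ⟨N, hN⟩) (Y := N') (Quiver.Hom.op (ObjectProperty.homMk g))).hom x)
      fun g g' => by
        have e : Quiver.Hom.op (ObjectProperty.homMk (g + g') :
            N'.unop ⟶ (⟨N, hN⟩ : M.FullSubcategory)) =
          Quiver.Hom.op (ObjectProperty.homMk g) + Quiver.Hom.op (ObjectProperty.homMk g') := rfl
        rw [e, F.obj.map_add]
        rfl)
     naturality := fun N₁ N₂ u => by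
      ext (g : N₁.unop.obj ⟶ N)
      have e : Quiver.Hom.op (ObjectProperty.homMk (u.unop.hom ≫ g) :
            N₂.unop ⟶ (⟨N, hN⟩ : M.FullSubcategory)) =
          Quiver.Hom.op (X := N₁.unop) (ObjectProperty.homMk g) ≫ u := rfl
      change (F.obj.map (X := op ⟨N, hN⟩) (Y := N₂)
        (Quiver.Hom.op (ObjectProperty.homMk (u.unop.hom ≫ g)))).hom x = _
      rw [e, F.obj.map_comp]
      rfl }⟩

/-- By Yoneda, morphisms out of Ψ N are elements at N, and epimorphisms are surjective there. -/
lemma projective_psi_obj {N : C} (hN : M N) : Projective ((psi M).obj (op N)) := by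
  refine ⟨fun {F G} f g _ => ?_⟩
  obtain ⟨x, hx⟩ := AddModule.eval_surjective_of_epi g ⟨N, hN⟩
    (AddModule.eval f ⟨N, hN⟩ (𝟙 N : N ⟶ N))
  refine ⟨psiDesc hN x, AddModule.hom_ext fun N' (k : N ⟶ N'.obj) => ?_⟩
  let u : (⟨N, hN⟩ : M.FullSubcategory) ⟶ N' := ObjectProperty.homMk k
  have e := AddModule.eval_naturality f u (𝟙 N : N ⟶ N)
  rw [← hx, ← AddModule.eval_naturality] at e
  refine e.symm.trans (congrArg _ ?_)
  exact Category.id_comp k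

lemma projective_phi_obj {N : C} (hN : M N) : Projective ((phi M).obj N) := by
  refine ⟨fun {F G} f g _ => ?_⟩
  obtain ⟨x, hx⟩ := AddModule.eval_surjective_of_epi g (op ⟨N, hN⟩)
    (AddModule.eval f (op ⟨N, hN⟩) (𝟙 N : N ⟶ N))
  refine ⟨phiDesc hN x, AddModule.hom_ext fun N' (k : N'.unop.obj ⟶ N) => ?_⟩
  let u : op (⟨N, hN⟩ : M.FullSubcategory) ⟶ N' := Quiver.Hom.op (ObjectProperty.homMk k)
  have e := AddModule.eval_naturality f u (𝟙 N : N ⟶ N)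
  rw [← hx, ← AddModule.eval_naturality] at e
  refine e.symm.trans (congrArg _ ?_)
  exact Category.comp_id k

end

/-! ### Images of extensions under Ψ and Φ -/

section
open Opposite

variable {C : Type u} [Category.{v} C] [Preadditive C] {𝓔 : ExactStructure C}

namespace ExactStructure

section
variable {A : Type u'} [Category.{v'} A] [Abelian A] [HasExt.{w} A]

/-- The morphism of short complexes induced by a morphism of conflations. -/
def IsConflation.homMk {X E Z X' E' Z' : C} {i : X ⟶ E} {p : E ⟶ Z} (h : 𝓔.IsConflation i p)
    {i' : X' ⟶ E'} {p' : E' ⟶ Z'} (h' : 𝓔.IsConflation i' p') {α : X ⟶ X'} {γ : E ⟶ E'}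
    {β : Z ⟶ Z'} (h₁ : i ≫ γ = α ≫ i') (h₂ : p ≫ β = γ ≫ p') :
    ShortComplex.mk i p h.zero ⟶ ShortComplex.mk i' p' h'.zero where
  τ₁ := α
  τ₂ := γ
  τ₃ := β
  comm₁₂ := h₁.symm
  comm₂₃ := h₂.symm

/-- The class in `Ext¹(G X, G Z)` of the image of a conflation `X ⟶ E ⟶ Z` under a contravariant
functor. -/
noncomputable def opExtClass (G : Cᵒᵖ ⥤ A) [G.Additive] {X E Z : C} {i : X ⟶ E} {p : E ⟶ Z}
    (h : 𝓔.IsConflation i p) (hS : (YonedaExtension.opMapShortComplex G h).ShortExact) :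
    Abelian.Ext.{w} (G.obj (op X)) (G.obj (op Z)) 1 := hS.extClass

/-- The class in `Ext¹(F Z, F X)` of the image of a conflation `X ⟶ E ⟶ Z` under a covariant
functor. -/
noncomputable def mapExtClass (F : C ⥤ A) [F.Additive] {X E Z : C} {i : X ⟶ E} {p : E ⟶ Z}
    (h : 𝓔.IsConflation i p) (hS : ((ShortComplex.mk i p h.zero).map F).ShortExact) :
    Abelian.Ext.{w} (F.obj Z) (F.obj X) 1 := hS.extClass

lemma opExtClass_naturality (G : Cᵒᵖ ⥤ A) [G.Additive] {X E Z X' E' Z' : C} {i : X ⟶ E}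
    {p : E ⟶ Z} (h : 𝓔.IsConflation i p) {i' : X' ⟶ E'} {p' : E' ⟶ Z'}
    (h' : 𝓔.IsConflation i' p') {α : X ⟶ X'} {γ : E ⟶ E'} {β : Z ⟶ Z'} (h₁ : i ≫ γ = α ≫ i')
    (h₂ : p ≫ β = γ ≫ p') (hS : (YonedaExtension.opMapShortComplex G h).ShortExact)
    (hS' : (YonedaExtension.opMapShortComplex G h').ShortExact) :
    (Abelian.Ext.mk₀ (G.map α.op)).comp (opExtClass G h hS) (zero_add 1) =
      (opExtClass G h' hS').comp (Abelian.Ext.mk₀ (G.map β.op)) (add_zero 1) :=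
  (hS'.extClass_naturality hS
    (G.mapShortComplex.map (ShortComplex.opMap (h.homMk h' h₁ h₂)))).symm

lemma mapExtClass_naturality (F : C ⥤ A) [F.Additive] {X E Z X' E' Z' : C} {i : X ⟶ E}
    {p : E ⟶ Z} (h : 𝓔.IsConflation i p) {i' : X' ⟶ E'} {p' : E' ⟶ Z'}
    (h' : 𝓔.IsConflation i' p') {α : X ⟶ X'} {γ : E ⟶ E'} {β : Z ⟶ Z'} (h₁ : i ≫ γ = α ≫ i')
    (h₂ : p ≫ β = γ ≫ p') (hS : ((ShortComplex.mk i p h.zero).map F).ShortExact)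
    (hS' : ((ShortComplex.mk i' p' h'.zero).map F).ShortExact) :
    (mapExtClass F h hS).comp (Abelian.Ext.mk₀ (F.map α)) (add_zero 1) =
      (Abelian.Ext.mk₀ (F.map β)).comp (mapExtClass F h' hS') (zero_add 1) :=
  hS.extClass_naturality hS' (F.mapShortComplex.map (h.homMk h' h₁ h₂))

namespace YonedaExtension

lemma opMapClass_splice (G : Cᵒᵖ ⥤ A) [G.Additive] {X Z E Y : C} {n : ℕ} {i : Z ⟶ E} {p : E ⟶ Y}
    (h : 𝓔.IsConflation i p) (ξ : 𝓔.YonedaExtension X (n + 1) Z)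
    (hξ : (splice i p h ξ).OpMapExact G) :
    (splice i p h ξ).opMapClass G hξ =
      (ξ.opMapClass G hξ.2).comp (opExtClass G h hξ.1) rfl := rfl

lemma mapClass_splice (F : C ⥤ A) [F.Additive] {X Z E Y : C} {n : ℕ} {i : Z ⟶ E} {p : E ⟶ Y}
    (h : 𝓔.IsConflation i p) (ξ : 𝓔.YonedaExtension X (n + 1) Z)
    (hξ : (splice i p h ξ).MapExact F) :
    (splice i p h ξ).mapClass F hξ =
      (mapExtClass F h hξ.1).comp (ξ.mapClass F hξ.2) (add_comm 1 (n + 1)) := rfl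

/-- Naturality of the image class, with exactness of both images assumed. It does not yield
invariance under zigzags, whose intermediate terms may fail to stay exact. -/
lemma HasMor.opMapClass (G : Cᵒᵖ ⥤ A) [G.Additive] {X X' : C} {α : X ⟶ X'} {n : ℕ} {Y : C}
    (ξ : 𝓔.YonedaExtension X n Y) : ∀ {Y' : C} {β : Y ⟶ Y'} {η : 𝓔.YonedaExtension X' n Y'}
    (_ : HasMor α ξ η β) (hξ : ξ.OpMapExact G) (hη : η.OpMapExact G),
    (Abelian.Ext.mk₀ (G.map α.op)).comp (ξ.opMapClass G hξ) (zero_add n) =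
      (η.opMapClass G hη).comp (Abelian.Ext.mk₀ (G.map β.op)) (add_zero n) := by
  induction ξ with
  | hom f =>
    rintro _ β (_ | _ | _) H hξ hη
    simp only [HasMor] at H
    simp only [YonedaExtension.opMapClass, Abelian.Ext.mk₀_comp_mk₀, ← G.map_comp, ← op_comp, H]
  | single i p h =>
    rintro _ β (_ | ⟨i', p', h'⟩ | _) ⟨γ, h₁, h₂⟩ hξ hη
    exact opExtClass_naturality G h h' h₁ h₂ hξ hη
  | splice i p h ξ ih =>
    rintro _ β (_ | _ | ⟨i', p', h', η⟩) ⟨ζ, γ, h₁, h₂, H⟩ hξ hη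
    rw [opMapClass_splice, opMapClass_splice,
      ← Abelian.Ext.comp_assoc _ _ _ (zero_add _) rfl (by lia), ih H hξ.2 hη.2,
      Abelian.Ext.comp_assoc _ _ _ (add_zero _) (zero_add 1) rfl,
      opExtClass_naturality G h h' h₁ h₂ hξ.1 hη.1,
      Abelian.Ext.comp_assoc _ _ _ rfl (add_zero 1) rfl]

lemma HasMor.mapClass (F : C ⥤ A) [F.Additive] {X X' : C} {α : X ⟶ X'} {n : ℕ} {Y : C}
    (ξ : 𝓔.YonedaExtension X n Y) : ∀ {Y' : C} {β : Y ⟶ Y'} {η : 𝓔.YonedaExtension X' n Y'}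
    (_ : HasMor α ξ η β) (hξ : ξ.MapExact F) (hη : η.MapExact F),
    (ξ.mapClass F hξ).comp (Abelian.Ext.mk₀ (F.map α)) (add_zero n) =
      (Abelian.Ext.mk₀ (F.map β)).comp (η.mapClass F hη) (zero_add n) := by
  induction ξ with
  | hom f =>
    rintro _ β (_ | _ | _) H hξ hη
    simp only [HasMor] at H
    simp only [YonedaExtension.mapClass, Abelian.Ext.mk₀_comp_mk₀, ← F.map_comp, H]
  | single i p h =>
    rintro _ β (_ | ⟨i', p', h'⟩ | _) ⟨γ, h₁, h₂⟩ hξ hη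
    exact mapExtClass_naturality F h h' h₁ h₂ hξ hη
  | splice i p h ξ ih =>
    rintro _ β (_ | _ | ⟨i', p', h', η⟩) ⟨ζ, γ, h₁, h₂, H⟩ hξ hη
    rw [mapClass_splice, mapClass_splice,
      Abelian.Ext.comp_assoc _ _ _ (add_comm 1 _) (add_zero _) (add_comm 1 _), ih H hξ.2 hη.2,
      ← Abelian.Ext.comp_assoc _ _ _ (add_zero 1) (zero_add _) (add_comm 1 _),
      mapExtClass_naturality F h h' h₁ h₂ hξ.1 hη.1,
      Abelian.Ext.comp_assoc _ _ _ (zero_add 1) (add_comm 1 _) (by lia)]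

end YonedaExtension

/-- The class `y` is the class of the image under the contravariant functor `G` of an extension
representing `x` whose image is exact. -/
def OpMapRel (G : Cᵒᵖ ⥤ A) [G.Additive] {n : ℕ} {X Y : C} (x : 𝓔.Ext n Y X)
    (y : Abelian.Ext.{w} (G.obj (op X)) (G.obj (op Y)) n) : Prop :=
  ∃ (ξ : 𝓔.YonedaExtension X n Y) (hξ : ξ.OpMapExact G), Ext.mk ξ = x ∧ ξ.opMapClass G hξ = y

/-- The class `y` is the class of the image under the covariant functor `F` of an extension
representing `x` whose image is exact. -/
def MapRel (F : C ⥤ A) [F.Additive] {n : ℕ} {X Y : C} (x : 𝓔.Ext n Y X)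
    (y : Abelian.Ext.{w} (F.obj Y) (F.obj X) n) : Prop :=
  ∃ (ξ : 𝓔.YonedaExtension X n Y) (hξ : ξ.MapExact F), Ext.mk ξ = x ∧ ξ.mapClass F hξ = y

lemma opMapRel_zero_iff (G : Cᵒᵖ ⥤ A) [G.Additive] {X Y : C} (f : Y ⟶ X)
    (y : Abelian.Ext.{w} (G.obj (op X)) (G.obj (op Y)) 0) :
    OpMapRel G (Ext.mk (.hom f) : 𝓔.Ext 0 Y X) y ↔ y = Abelian.Ext.mk₀ (G.map f.op) := by
  constructor
  · rintro ⟨_ | _ | _, hξ, h, rfl⟩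
    rw [← Ext.mk_hom_eq_iff.1 h]
    rfl
  · rintro rfl
    exact ⟨.hom f, True.intro, rfl, rfl⟩

lemma mapRel_zero_iff (F : C ⥤ A) [F.Additive] {X Y : C} (f : Y ⟶ X)
    (y : Abelian.Ext.{w} (F.obj Y) (F.obj X) 0) :
    MapRel F (Ext.mk (.hom f) : 𝓔.Ext 0 Y X) y ↔ y = Abelian.Ext.mk₀ (F.map f) := by
  constructor
  · rintro ⟨_ | _ | _, hξ, h, rfl⟩
    rw [← Ext.mk_hom_eq_iff.1 h]
    rfl
  · rintro rfl
    exact ⟨.hom f, True.intro, rfl, rfl⟩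

end

/-- A property of pairs of composable morphisms that is inherited by the push-outs and the
pull-backs of conflations. -/
structure StableUnderBaseChange (𝓔 : ExactStructure C)
    (Q : ∀ {X E Z : C}, (X ⟶ E) → (E ⟶ Z) → Prop) : Prop where
  pushout : ∀ {X E Z X' E' : C} {i : X ⟶ E} {p : E ⟶ Z} {i' : X' ⟶ E'} {p' : E' ⟶ Z} {f : X ⟶ X'}
    {f' : E ⟶ E'}, IsPushout i f f' i' → f' ≫ p' = p → Q i p → Q i' p'
  pullback : ∀ {X E Z E' Z' : C} {i : X ⟶ E} {p : E ⟶ Z} {i' : X ⟶ E'} {p' : E' ⟶ Z'} {f : Z' ⟶ Z}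
    {f' : E' ⟶ E}, IsPullback f' p' p f → i' ≫ f' = i → Q i p → Q i' p'

namespace YonedaExtension

/-- All the conflations from which an extension is spliced satisfy `Q`. -/
def All (Q : ∀ {X E Z : C}, (X ⟶ E) → (E ⟶ Z) → Prop) {X : C} :
    {n : ℕ} → {Y : C} → 𝓔.YonedaExtension X n Y → Prop
  | _, _, .hom _ => True
  | _, _, .single i p _ => Q i p
  | _, _, .splice i p _ ξ => Q i p ∧ All Q ξ

variable {Q : ∀ {X E Z : C}, (X ⟶ E) → (E ⟶ Z) → Prop}

lemma All.exists_pushout (hQ : StableUnderBaseChange 𝓔 Q) {X X' Y : C} {n : ℕ}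
    {ξ : 𝓔.YonedaExtension X n Y} (hξ : ξ.All Q) (α : X ⟶ X') :
    ∃ η : 𝓔.YonedaExtension X' n Y, HasMor α ξ η (𝟙 Y) ∧ η.All Q := by
  induction ξ with
  | hom f => exact ⟨.hom (f ≫ α), by simp [HasMor], True.intro⟩
  | single i p h =>
    obtain ⟨B, f', i', p', sq, hc, hp⟩ := h.exists_pushout α
    exact ⟨.single i' p' hc, ⟨f', sq.w, by simp [hp]⟩, hQ.pushout sq hp hξ⟩
  | splice i p h ξ ih =>
    obtain ⟨η, hη, hη'⟩ := ih hξ.2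
    exact ⟨.splice i p h η, ⟨𝟙 _, 𝟙 _, by simp, by simp, hη⟩, hξ.1, hη'⟩

lemma All.exists_pullback (hQ : StableUnderBaseChange 𝓔 Q) {X Y Y' : C} {n : ℕ}
    {ξ : 𝓔.YonedaExtension X n Y} (hξ : ξ.All Q) (β : Y' ⟶ Y) :
    ∃ η : 𝓔.YonedaExtension X n Y', HasMor (𝟙 X) η ξ β ∧ η.All Q := by
  cases ξ with
  | hom f => exact ⟨.hom (β ≫ f), by simp [HasMor], True.intro⟩
  | single i p h =>
    obtain ⟨B, f', i', p', sq, hc, hp⟩ := h.exists_pullback β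
    exact ⟨.single i' p' hc, ⟨f', by simp [hp], sq.w.symm⟩, hQ.pullback sq hp hξ⟩
  | splice i p h ξ =>
    obtain ⟨B, f', i', p', sq, hc, hp⟩ := h.exists_pullback β
    exact ⟨.splice i' p' hc ξ, ⟨𝟙 _, f', by simp [hp], sq.w.symm, HasMor.id ξ⟩,
      hQ.pullback sq hp hξ.1, hξ.2⟩

end YonedaExtension

/-- For push-outs, the extension is glued by the universal property; for pull-backs, the extension
to E is restricted to E'. -/
lemma stableUnderBaseChange_extendsTo (𝓔 : ExactStructure C) (M : ObjectProperty C) :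
    StableUnderBaseChange 𝓔 (ExtendsTo M) where
  pushout {_ _ _ _ _ _ _ _ _ f _} sq _ h N hN g := by
    obtain ⟨e, he⟩ := h N hN (f ≫ g)
    exact ⟨sq.desc e g he, by simp⟩
  pullback {_ _ _ _ _ _ _ _ _ _ f'} _ hi h N hN g := by
    obtain ⟨e, he⟩ := h N hN g
    exact ⟨f' ≫ e, by dsimp only; rw [reassoc_of% hi]; exact he⟩

lemma stableUnderBaseChange_liftsFrom (𝓔 : ExactStructure C) (M : ObjectProperty C) :
    StableUnderBaseChange 𝓔 (LiftsFrom M) where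
  pushout {_ _ _ _ _ _ _ _ _ _ f'} _ hp h N hN g := by
    obtain ⟨e, he⟩ := h N hN g
    exact ⟨e ≫ f', by dsimp only; rw [Category.assoc, hp]; exact he⟩
  pullback {_ _ _ _ _ _ _ _ _ f _} sq _ h N hN g := by
    obtain ⟨e, he⟩ := h N hN (g ≫ f)
    exact ⟨sq.lift e g he, by simp⟩

variable {M : ObjectProperty C} {n : ℕ}

namespace YonedaExtension

lemma opMapExact_psi_iff {X Y : C} (ξ : 𝓔.YonedaExtension X n Y) :
    ξ.OpMapExact (psi M) ↔ ξ.All (ExtendsTo M) := by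
  induction ξ with
  | hom f => exact Iff.rfl
  | single i p h => exact shortExact_psi_iff h
  | splice i p h ξ ih => exact and_congr (shortExact_psi_iff h) ih

lemma mapExact_phi_iff {X Y : C} (ξ : 𝓔.YonedaExtension X n Y) :
    ξ.MapExact (phi M) ↔ ξ.All (LiftsFrom M) := by
  induction ξ with
  | hom f => exact Iff.rfl
  | single i p h => exact shortExact_phi_iff h
  | splice i p h ξ ih => exact and_congr (shortExact_phi_iff h) ih

end YonedaExtension

section Psi

/-- Base change of a Ψ-exact representative is again Ψ-exact. With `OpMapRel.pull` this is the whole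
source of naturality. -/
lemma OpMapRel.push {X X' Y : C} {x : 𝓔.Ext n Y X}
    {y : Abelian.Ext.{max u (v + 1)} ((psi M).obj (op X)) ((psi M).obj (op Y)) n}
    (H : OpMapRel (psi M) x y) (f : X ⟶ X') :
    OpMapRel (psi M) (Ext.push f x) ((Abelian.Ext.mk₀ ((psi M).map f.op)).comp y (zero_add n)) := by
  obtain ⟨ξ, hξ, rfl, rfl⟩ := H
  obtain ⟨η, h, hη⟩ := ((ξ.opMapExact_psi_iff).1 hξ).exists_pushout
    (stableUnderBaseChange_extendsTo 𝓔 M) f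
  refine ⟨η, (η.opMapExact_psi_iff).2 hη, (Ext.push_mk_eq h).symm, ?_⟩
  rw [h.opMapClass (psi M) _ hξ ((η.opMapExact_psi_iff).2 hη), op_id, CategoryTheory.Functor.map_id,
    Abelian.Ext.comp_mk₀_id]

lemma OpMapRel.pull {X Y Y' : C} {x : 𝓔.Ext n Y X}
    {y : Abelian.Ext.{max u (v + 1)} ((psi M).obj (op X)) ((psi M).obj (op Y)) n}
    (H : OpMapRel (psi M) x y) (g : Y' ⟶ Y) :
    OpMapRel (psi M) (Ext.pull g x) (y.comp (Abelian.Ext.mk₀ ((psi M).map g.op)) (add_zero n)) := by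
  obtain ⟨ξ, hξ, rfl, rfl⟩ := H
  obtain ⟨η, h, hη⟩ := ((ξ.opMapExact_psi_iff).1 hξ).exists_pullback
    (stableUnderBaseChange_extendsTo 𝓔 M) g
  refine ⟨η, (η.opMapExact_psi_iff).2 hη, (Ext.pull_mk_eq h).symm, ?_⟩
  rw [← h.opMapClass (psi M) _ ((η.opMapExact_psi_iff).2 hη) hξ, op_id,
    CategoryTheory.Functor.map_id, Abelian.Ext.mk₀_id_comp]

variable {X E Z : C} {i : X ⟶ E} {p : E ⟶ Z} (h : 𝓔.IsConflation i p)
  (hS : (YonedaExtension.opMapShortComplex (psi M) h).ShortExact)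

lemma OpMapRel.single : OpMapRel (psi M) (Ext.mk (.single i p h)) (opExtClass (psi M) h hS) :=
  ⟨.single i p h, hS, rfl, rfl⟩

lemma OpMapRel.spliceRight {X' : C} {x : 𝓔.Ext n X X'}
    {y : Abelian.Ext.{max u (v + 1)} ((psi M).obj (op X')) ((psi M).obj (op X)) n}
    (H : OpMapRel (psi M) x y) :
    OpMapRel (psi M) (Ext.spliceRight h x) (y.comp (opExtClass (psi M) h hS) rfl) := by
  obtain ⟨ξ, hξ, rfl, rfl⟩ := H
  cases n with
  | zero =>
    obtain ⟨f⟩ | _ | _ := ξ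
    exact (OpMapRel.single h hS).push f
  | succ n => exact ⟨.splice i p h ξ, ⟨hS, hξ⟩, rfl, rfl⟩

lemma OpMapRel.spliceLeft {Y : C} {x : 𝓔.Ext n Y Z}
    {y : Abelian.Ext.{max u (v + 1)} ((psi M).obj (op Z)) ((psi M).obj (op Y)) n}
    (H : OpMapRel (psi M) x y) :
    OpMapRel (psi M) (Ext.spliceLeft h x) ((opExtClass (psi M) h hS).comp y (add_comm 1 n)) := by
  obtain ⟨ξ, hξ, rfl, rfl⟩ := H
  induction ξ with
  | hom f => exact (OpMapRel.single h hS).pull f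
  | single j q k => exact OpMapRel.spliceRight k hξ (OpMapRel.single h hS)
  | splice j q k ξ ih =>
    have := OpMapRel.spliceRight k hξ.1 (ih hξ.2)
    rw [Abelian.Ext.comp_assoc _ _ _ _ rfl (by lia)] at this
    exact this

/-- An extension that remains exact under `Ψ` is spliced, up to equivalence, from any given
conflation `X ⟶ M₀ ⟶ Z` that remains exact and has its middle term in `M`. -/
lemma OpMapRel.exists_spliceLeft (hM : M E) {Y : C} {x : 𝓔.Ext (n + 1) Y X}
    {y : Abelian.Ext.{max u (v + 1)} ((psi M).obj (op X)) ((psi M).obj (op Y)) (n + 1)}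
    (H : OpMapRel (psi M) x y) :
    ∃ (x' : 𝓔.Ext n Y Z)
      (y' : Abelian.Ext.{max u (v + 1)} ((psi M).obj (op Z)) ((psi M).obj (op Y)) n),
      OpMapRel (psi M) x' y' ∧ Ext.spliceLeft h x' = x ∧
        (opExtClass (psi M) h hS).comp y' (add_comm 1 n) = y := by
  obtain ⟨ξ, hξ, rfl, rfl⟩ := H
  induction n generalizing Y with
  | zero =>
    obtain _ | ⟨j, q, k⟩ | _ := ξ
    -- Since the middle term E lies in M, Ψ-exactness of the other conflation extends i along j. The
    -- given conflation thus pulls back to the other one along the induced f.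
    obtain ⟨γ, hγ⟩ := (shortExact_psi_iff k).1 hξ E hM i
    dsimp only at hγ
    obtain ⟨f, hf⟩ := k.exists_desc (γ ≫ p) (by rw [reassoc_of% hγ, h.zero])
    have e : YonedaExtension.HasMor (𝟙 X) (.single j q k) (.single i p h) f :=
      ⟨γ, by simpa using hγ, hf⟩
    refine ⟨Ext.mk (.hom f), _, (opMapRel_zero_iff _ f _).2 rfl, Ext.pull_mk_eq e, ?_⟩
    have := e.opMapClass (psi M) _ hξ hS
    rw [op_id, CategoryTheory.Functor.map_id, Abelian.Ext.mk₀_id_comp] at this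
    exact this.symm
  | succ n ih =>
    obtain _ | _ | ⟨j, q, k, ξ⟩ := ξ
    obtain ⟨x', y', H, e₁, e₂⟩ := ih ξ hξ.2
    refine ⟨_, _, H.spliceRight k hξ.1, ?_, ?_⟩
    · rw [Ext.spliceLeft_spliceRight, e₁]
      rfl
    · rw [← Abelian.Ext.comp_assoc _ _ _ (add_comm 1 n) rfl (by lia), e₂]
      rfl

end Psi

section Phi

lemma MapRel.push {X X' Y : C} {x : 𝓔.Ext n Y X}
    {y : Abelian.Ext.{max u (v + 1)} ((phi M).obj Y) ((phi M).obj X) n}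
    (H : MapRel (phi M) x y) (f : X ⟶ X') :
    MapRel (phi M) (Ext.push f x) (y.comp (Abelian.Ext.mk₀ ((phi M).map f)) (add_zero n)) := by
  obtain ⟨ξ, hξ, rfl, rfl⟩ := H
  obtain ⟨η, h, hη⟩ := ((ξ.mapExact_phi_iff).1 hξ).exists_pushout
    (stableUnderBaseChange_liftsFrom 𝓔 M) f
  refine ⟨η, (η.mapExact_phi_iff).2 hη, (Ext.push_mk_eq h).symm, ?_⟩
  rw [h.mapClass (phi M) _ hξ ((η.mapExact_phi_iff).2 hη), CategoryTheory.Functor.map_id,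
    Abelian.Ext.mk₀_id_comp]

lemma MapRel.pull {X Y Y' : C} {x : 𝓔.Ext n Y X}
    {y : Abelian.Ext.{max u (v + 1)} ((phi M).obj Y) ((phi M).obj X) n}
    (H : MapRel (phi M) x y) (g : Y' ⟶ Y) :
    MapRel (phi M) (Ext.pull g x) ((Abelian.Ext.mk₀ ((phi M).map g)).comp y (zero_add n)) := by
  obtain ⟨ξ, hξ, rfl, rfl⟩ := H
  obtain ⟨η, h, hη⟩ := ((ξ.mapExact_phi_iff).1 hξ).exists_pullback
    (stableUnderBaseChange_liftsFrom 𝓔 M) g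
  refine ⟨η, (η.mapExact_phi_iff).2 hη, (Ext.pull_mk_eq h).symm, ?_⟩
  rw [← h.mapClass (phi M) _ ((η.mapExact_phi_iff).2 hη) hξ, CategoryTheory.Functor.map_id,
    Abelian.Ext.comp_mk₀_id]

variable {Z E Y : C} {i : Z ⟶ E} {p : E ⟶ Y} (h : 𝓔.IsConflation i p)
  (hS : ((ShortComplex.mk i p h.zero).map (phi M)).ShortExact)

lemma MapRel.spliceRight {X : C} {x : 𝓔.Ext n Z X}
    {y : Abelian.Ext.{max u (v + 1)} ((phi M).obj Z) ((phi M).obj X) n}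
    (H : MapRel (phi M) x y) :
    MapRel (phi M) (Ext.spliceRight h x) ((mapExtClass (phi M) h hS).comp y (add_comm 1 n)) := by
  obtain ⟨ξ, hξ, rfl, rfl⟩ := H
  cases n with
  | zero =>
    obtain ⟨f⟩ | _ | _ := ξ
    exact MapRel.push ⟨.single i p h, hS, rfl, rfl⟩ f
  | succ n => exact ⟨.splice i p h ξ, ⟨hS, hξ⟩, rfl, rfl⟩

/-- An extension that remains exact under `Φ` is spliced, up to equivalence, from any given
conflation `Z ⟶ M₀ ⟶ Y` that remains exact and has its middle term in `M`. -/
lemma MapRel.exists_spliceRight (hM : M E) {X : C} {x : 𝓔.Ext (n + 1) Y X}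
    {y : Abelian.Ext.{max u (v + 1)} ((phi M).obj Y) ((phi M).obj X) (n + 1)}
    (H : MapRel (phi M) x y) :
    ∃ (x' : 𝓔.Ext n Z X) (y' : Abelian.Ext.{max u (v + 1)} ((phi M).obj Z) ((phi M).obj X) n),
      MapRel (phi M) x' y' ∧ Ext.spliceRight h x' = x ∧
        (mapExtClass (phi M) h hS).comp y' (add_comm 1 n) = y := by
  obtain ⟨ξ, hξ, rfl, rfl⟩ := H
  cases n with
  | zero =>
    obtain _ | ⟨j, q, k⟩ | _ := ξ
    obtain ⟨γ, hγ⟩ := (shortExact_phi_iff k).1 hξ E hM p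
    dsimp only at hγ
    obtain ⟨f, hf⟩ := k.exists_lift (i ≫ γ) (by rw [Category.assoc, hγ, h.zero])
    have e : YonedaExtension.HasMor f (.single i p h) (.single j q k) (𝟙 Y) :=
      ⟨γ, hf.symm, by simpa using hγ.symm⟩
    refine ⟨Ext.mk (.hom f), _, (mapRel_zero_iff _ f _).2 rfl, Ext.push_mk_eq e, ?_⟩
    have := e.mapClass (phi M) _ hS hξ
    rw [CategoryTheory.Functor.map_id, Abelian.Ext.mk₀_id_comp] at this
    exact this
  | succ n =>
    obtain _ | _ | ⟨j, q, k, ξ⟩ := ξ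
    -- Extensions are built from the right, so only the last conflation has to be replaced and no
    -- induction is needed, unlike for Ψ.
    obtain ⟨γ, hγ⟩ := (shortExact_phi_iff k).1 hξ.1 E hM p
    dsimp only at hγ
    obtain ⟨ζ, hζ⟩ := k.exists_lift (i ≫ γ) (by rw [Category.assoc, hγ, h.zero])
    have H : MapRel (phi M) (Ext.mk ξ) (ξ.mapClass (phi M) hξ.2) := ⟨ξ, hξ.2, rfl, rfl⟩
    refine ⟨_, _, H.pull ζ, Ext.spliceRight_pull_of_refines h k hζ.symm hγ.symm _, ?_⟩
    have := mapExtClass_naturality (phi M) h k hζ.symm (β := 𝟙 Y) (by simpa using hγ.symm) hS hξ.1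
    rw [CategoryTheory.Functor.map_id, Abelian.Ext.mk₀_id_comp] at this
    rw [← Abelian.Ext.comp_assoc _ _ _ (add_zero 1) (zero_add _) (by lia), this]
    rfl

end Phi

end ExactStructure
end

/-- Given two surjections and an isomorphism between their sources that identifies their kernels,
there is an induced isomorphism between their targets. -/
lemma AddEquiv.exists_of_surjective {A A' B B' : Type*} [AddCommGroup A] [AddCommGroup A']
    [AddCommGroup B] [AddCommGroup B'] (g : A →+ A') (hg : Function.Surjective g) (g' : B →+ B')
    (hg' : Function.Surjective g') (e : A ≃+ B) (h : ∀ a, g a = 0 ↔ g' (e a) = 0) :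
    ∃ e' : A' ≃+ B', ∀ a, e' (g a) = g' (e a) := by
  choose s hs using hg
  -- The choice of preimages is immaterial because the kernels correspond.
  have key : ∀ a, g' (e (s (g a))) = g' (e a) := fun a => by
    rw [← sub_eq_zero, ← map_sub, ← map_sub, ← h, map_sub, hs, sub_self]
  let φ : A' →+ B' := AddMonoidHom.mk' (fun x => g' (e (s x))) fun x y => by
    rw [← map_add, ← map_add, ← key (s x + s y), map_add g, hs, hs]
  refine ⟨AddEquiv.ofBijective φ ⟨(injective_iff_map_eq_zero φ).2 fun x hx => ?_, fun y => ?_⟩,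
    key⟩
  · rw [← hs x, h]
    exact hx
  · obtain ⟨b, rfl⟩ := hg' y
    obtain ⟨a, rfl⟩ := e.surjective b
    exact ⟨g a, key a⟩

/-! ### Dimension shifting -/

section
open Opposite

variable {C : Type u} [Category.{v} C] [Preadditive C] {𝓔 : ExactStructure C}
  {M : ObjectProperty C}

namespace ExactStructure

/-- There is an exact sequence `0 ⟶ X ⟶ M₀ ⟶ ⋯ ⟶ Mₖ ⟶ Z ⟶ 0` spliced from `k + 1` conflations
along which the morphisms to objects of `M` extend. -/
def HasCoresolution (𝓔 : ExactStructure C) (M : ObjectProperty C) : ℕ → C → Prop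
  | 0, X => ∃ (M₀ Z : C) (i : X ⟶ M₀) (p : M₀ ⟶ Z),
      M M₀ ∧ 𝓔.IsConflation i p ∧ ExtendsTo M i p
  | k + 1, X => ∃ (M₀ Z : C) (i : X ⟶ M₀) (p : M₀ ⟶ Z),
      M M₀ ∧ 𝓔.IsConflation i p ∧ ExtendsTo M i p ∧ HasCoresolution 𝓔 M k Z

/-- There is an exact sequence `0 ⟶ Z ⟶ Mₖ ⟶ ⋯ ⟶ M₀ ⟶ Y ⟶ 0` spliced from `k + 1` conflations
along which the morphisms from objects of `M` lift. -/
def HasResolution (𝓔 : ExactStructure C) (M : ObjectProperty C) : ℕ → C → Prop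
  | 0, Y => ∃ (M₀ Z : C) (i : Z ⟶ M₀) (p : M₀ ⟶ Y),
      M M₀ ∧ 𝓔.IsConflation i p ∧ LiftsFrom M i p
  | k + 1, Y => ∃ (M₀ Z : C) (i : Z ⟶ M₀) (p : M₀ ⟶ Y),
      M M₀ ∧ 𝓔.IsConflation i p ∧ LiftsFrom M i p ∧ HasResolution 𝓔 M k Z

lemma HasCoresolution.exists_conflation {k : ℕ} {X : C} (h : 𝓔.HasCoresolution M k X) :
    ∃ (M₀ Z : C) (i : X ⟶ M₀) (p : M₀ ⟶ Z), M M₀ ∧ 𝓔.IsConflation i p ∧ ExtendsTo M i p := by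
  cases k with
  | zero => exact h
  | succ k =>
    obtain ⟨M₀, Z, i, p, h₁, h₂, h₃, -⟩ := h
    exact ⟨M₀, Z, i, p, h₁, h₂, h₃⟩

lemma HasResolution.exists_conflation {k : ℕ} {Y : C} (h : 𝓔.HasResolution M k Y) :
    ∃ (M₀ Z : C) (i : Z ⟶ M₀) (p : M₀ ⟶ Y), M M₀ ∧ 𝓔.IsConflation i p ∧ LiftsFrom M i p := by
  cases k with
  | zero => exact h
  | succ k =>
    obtain ⟨M₀, Z, i, p, h₁, h₂, h₃, -⟩ := h
    exact ⟨M₀, Z, i, p, h₁, h₂, h₃⟩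

/-- Exactness of the Hom complex at Hom(Mⱼ, N) for j < k says, after cancelling the epimorphism π j,
that morphisms from Zⱼ₊₁ to N extend along ι (j + 1). With surjectivity at the end, this covers all
k + 1 conflations. -/
lemma hasCoresolution_of_cogen {k : ℕ} {X : C} (hX : 𝓔.cogen M k X) :
    𝓔.HasCoresolution M k X := by
  obtain ⟨Z, M', ι, π, rfl, hc, hex⟩ := hX
  have key : ∀ j ≤ k, ExtendsTo M (ι j) (π j) := by
    rintro (_ | _ | j) hj N hN
    · exact (hex N hN).1
    · intro g
      have := (hc 0 (by lia)).2.epi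
      obtain ⟨g', hg'⟩ := ((hex N hN).2.1 hj (π 0 ≫ g)).1
        (by simp [reassoc_of% (hc 0 (by lia)).2.zero])
      exact ⟨g', by rw [← cancel_epi (π 0)]; simpa using hg'⟩
    · intro g
      have := (hc (j + 1) (by lia)).2.epi
      obtain ⟨g', hg'⟩ := ((hex N hN).2.2 j hj (π (j + 1) ≫ g)).1
        (by simp [reassoc_of% (hc (j + 1) (by lia)).2.zero])
      exact ⟨g', by rw [← cancel_epi (π (j + 1))]; simpa using hg'⟩
  have H : ∀ m j, j + m ≤ k → 𝓔.HasCoresolution M m (Z j) := by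
    intro m
    induction m with
    | zero => exact fun j hj => ⟨_, _, ι j, π j, (hc j hj).1, (hc j hj).2, key j hj⟩
    | succ m ih =>
      exact fun j hj => ⟨_, _, ι j, π j, (hc j (by lia)).1, (hc j (by lia)).2, key j (by lia),
        ih (j + 1) (by lia)⟩
  exact H k 0 (by lia)

lemma hasResolution_of_gen {k : ℕ} {Y : C} (hY : 𝓔.gen M k Y) : 𝓔.HasResolution M k Y := by
  obtain ⟨Z, M', ι, π, rfl, hc, hex⟩ := hY
  have key : ∀ j ≤ k, LiftsFrom M (ι j) (π j) := by
    rintro (_ | _ | j) hj N hN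
    · exact (hex N hN).1
    · intro g
      have := (hc 0 (by lia)).2.mono
      obtain ⟨g', hg'⟩ := ((hex N hN).2.1 hj (g ≫ ι 0)).1
        (by simp [(hc 0 (by lia)).2.zero])
      exact ⟨g', by rw [← cancel_mono (ι 0)]; simpa using hg'⟩
    · intro g
      have := (hc (j + 1) (by lia)).2.mono
      obtain ⟨g', hg'⟩ := ((hex N hN).2.2 j hj (g ≫ ι (j + 1))).1
        (by simp [reassoc_of% (hc (j + 1) (by lia)).2.zero])
      exact ⟨g', by rw [← cancel_mono (ι (j + 1))]; simpa using hg'⟩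
  have H : ∀ m j, j + m ≤ k → 𝓔.HasResolution M m (Z j) := by
    intro m
    induction m with
    | zero => exact fun j hj => ⟨_, _, ι j, π j, (hc j hj).1, (hc j hj).2, key j hj⟩
    | succ m ih =>
      exact fun j hj => ⟨_, _, ι j, π j, (hc j (by lia)).1, (hc j (by lia)).2, key j (by lia),
        ih (j + 1) (by lia)⟩
  exact H k 0 (by lia)

variable [HasZeroObject C] [HasBinaryBiproducts C]

/-- The conflation 0 ⟶ E ⟶ E maps to the given one with zero on the left, so the class is pushed out
along zero. -/
lemma Ext.spliceLeft_push_self {n : ℕ} {X E Z : C} {i : X ⟶ E} {p : E ⟶ Z}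
    (h : 𝓔.IsConflation i p) {Y : C} (m : 𝓔.Ext n Y E) : spliceLeft h (push p m) = 0 := by
  rw [← push_spliceLeft (𝓔.isConflation_zero_id (isZero_zero C) E) h (α := 0) (γ := 𝟙 E)
    (by simp) (by simp), push_zero_mor]

lemma leftExtOrthogonal.mono {k k' : ℕ} (hk : k ≤ k') {Y : C}
    (hY : 𝓔.leftExtOrthogonal M k' Y) : 𝓔.leftExtOrthogonal M k Y :=
  fun i hi hik => hY i hi (hik.trans_le hk)

lemma rightExtOrthogonal.mono {k k' : ℕ} (hk : k ≤ k') {X : C}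
    (hX : 𝓔.rightExtOrthogonal M k' X) : 𝓔.rightExtOrthogonal M k X :=
  fun i hi hik => hX i hi (hik.trans_le hk)

/-- Stating that e has graph `OpMapRel` is what makes the induction close: it computes e on
push-outs of morphisms and includes independence of the representative. The condition i < k leaves
two conflations when degree zero is reached. -/
theorem exists_addEquiv_psi (i k : ℕ) (hi : i < k) (X Y : C) (hX : 𝓔.HasCoresolution M k X)
    (hY : 𝓔.leftExtOrthogonal M k Y) :
    ∃ e : 𝓔.Ext i Y X ≃+ Abelian.Ext.{max u (v + 1)}
      ((psi M).obj (op X)) ((psi M).obj (op Y)) i, ∀ x y, e x = y ↔ OpMapRel (psi M) x y := by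
  induction i generalizing k X with
  | zero =>
    obtain _ | k := k
    · lia
    obtain ⟨M₀, Z, a, p, h₀, h, H, hZ⟩ := hX
    obtain ⟨M₁, Z', a', p', h₁, h', -⟩ := hZ.exists_conflation
    let f : (Y ⟶ X) ≃+ ((psi M).obj (op X) ⟶ (psi M).obj (op Y)) :=
      AddEquiv.ofBijective (AddMonoidHom.mk' (fun f : Y ⟶ X => (psi M).map f.op)
        fun f g => (psi M).map_add) (psi_map_bijective h h' h₀ h₁ H)
    refine ⟨(Ext.homAddEquiv Y X).symm.trans (f.trans Abelian.Ext.addEquiv₀.symm), fun x y => ?_⟩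
    obtain ⟨g, rfl⟩ := (Ext.homAddEquiv Y X).surjective x
    rw [AddEquiv.trans_apply, AddEquiv.symm_apply_apply]
    exact eq_comm.trans (opMapRel_zero_iff (psi M) g y).symm
  | succ i ih =>
    obtain _ | k := k
    · lia
    obtain ⟨M₀, Z, a, p, h₀, h, H, hZ⟩ := hX
    obtain ⟨e, he⟩ := ih k (by lia) Z hZ (leftExtOrthogonal.mono (by lia) hY)
    have hS := (shortExact_psi_iff h).2 H
    have := projective_psi_obj h₀
    have hP : ∀ (y : Abelian.Ext.{max u (v + 1)} ((psi M).obj (op M₀)) ((psi M).obj (op Y))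
        (i + 1)), y = 0 := fun y => y.eq_zero_of_projective
    -- `hpush` and `hpush'` match the images of the Ext groups at M₀. For i = 0 this is the action
    -- of Ψ on morphisms, surjective by Yoneda; for i > 0 orthogonality and projectivity make both
    -- groups zero.
    have hpush : ∀ m : 𝓔.Ext i Y M₀, ∃ m', e (Ext.push p m) =
        (Abelian.Ext.mk₀ ((psi M).map p.op)).comp m' (zero_add i) := by
      intro m
      cases i with
      | zero =>
        obtain ⟨g, rfl⟩ := Ext.exists_mk_hom m
        exact ⟨_, (he _ _).2 (OpMapRel.push ((opMapRel_zero_iff _ g _).2 rfl) p)⟩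
      | succ i =>
        exact ⟨0, by rw [hY _ (by lia) (by lia) M₀ h₀ m, Ext.push_zero, map_zero,
          Abelian.Ext.comp_zero]⟩
    have hpush' : ∀ m' : Abelian.Ext.{max u (v + 1)} ((psi M).obj (op M₀)) ((psi M).obj (op Y)) i,
        ∃ m : 𝓔.Ext i Y M₀, e (Ext.push p m) =
          (Abelian.Ext.mk₀ ((psi M).map p.op)).comp m' (zero_add i) := by
      intro m'
      cases i with
      | zero =>
        obtain ⟨β, rfl⟩ := (Abelian.Ext.mk₀_bijective _ _).2 m'
        obtain ⟨g, rfl⟩ := psi_map_surjective_of_prop h₀ β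
        exact ⟨_, (he _ _).2 (OpMapRel.push ((opMapRel_zero_iff _ g _).2 rfl) p)⟩
      | succ i =>
        exact ⟨0, by rw [Abelian.Ext.eq_zero_of_projective m', Ext.push_zero, map_zero,
          Abelian.Ext.comp_zero]⟩
    -- By exactness, the kernels of the connecting maps are the images just matched.
    have hker : ∀ x, Ext.spliceLeftHom h Y i x = 0 ↔ (opExtClass (psi M) h hS).precomp
        ((psi M).obj (op Y)) (add_comm 1 i) (e x) = 0 := by
      refine fun x => ⟨fun hx => ?_, fun hx => ?_⟩
      · obtain ⟨m, rfl⟩ := Ext.exists_push_eq h x hx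
        obtain ⟨m', hm'⟩ := hpush m
        rw [hm']
        exact hS.extClass_comp_assoc (h := add_comm 1 i) m'
      · obtain ⟨m', hm'⟩ := Abelian.Ext.contravariant_sequence_exact₁ hS _ (e x)
          (add_comm 1 i) hx
        obtain ⟨m, hm⟩ := hpush' m'
        rw [e.injective (hm'.symm.trans hm.symm)]
        exact Ext.spliceLeft_push_self h m
    obtain ⟨e', he'⟩ := AddEquiv.exists_of_surjective (Ext.spliceLeftHom h Y i)
      (fun x => Ext.exists_spliceLeft h x (hY _ (by lia) hi M₀ h₀ _))
      ((opExtClass (psi M) h hS).precomp ((psi M).obj (op Y)) (add_comm 1 i))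
      (fun y => Abelian.Ext.contravariant_sequence_exact₃ hS _ y (hP _) (add_comm 1 i)) e hker
    refine ⟨e', fun x y => ⟨?_, fun hxy => ?_⟩⟩
    · rintro rfl
      obtain ⟨x, rfl⟩ := Ext.exists_spliceLeft h x (hY _ (by lia) hi M₀ h₀ _)
      exact (he' x).symm ▸ OpMapRel.spliceLeft h hS ((he _ _).1 rfl)
    -- An arbitrary Ψ-exact representative is rewritten as spliced from the chosen conflation, where
    -- e' is known by construction.
    · obtain ⟨x', y', hxy', rfl, rfl⟩ := OpMapRel.exists_spliceLeft h hS h₀ hxy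
      rw [← (he _ _).2 hxy']
      exact he' x'

/-- The dual shift runs along Z ⟶ M₀ ⟶ Y and uses the contravariant exact sequence in 𝓔. Φ is
covariant, but the shift is again in the first variable of the module Ext, with Φ M₀ projective. -/
theorem exists_addEquiv_phi (i k : ℕ) (hi : i < k) (X Y : C) (hY : 𝓔.HasResolution M k Y)
    (hX : 𝓔.rightExtOrthogonal M k X) :
    ∃ e : 𝓔.Ext i Y X ≃+ Abelian.Ext.{max u (v + 1)} ((phi M).obj Y) ((phi M).obj X) i,
      ∀ x y, e x = y ↔ MapRel (phi M) x y := by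
  induction i generalizing k Y with
  | zero =>
    obtain _ | k := k
    · lia
    obtain ⟨M₀, Z, a, p, h₀, h, H, hZ⟩ := hY
    obtain ⟨M₁, Z', a', p', h₁, h', -⟩ := hZ.exists_conflation
    let f : (Y ⟶ X) ≃+ ((phi M).obj Y ⟶ (phi M).obj X) :=
      AddEquiv.ofBijective (AddMonoidHom.mk' (fun f : Y ⟶ X => (phi M).map f)
        fun f g => (phi M).map_add) (phi_map_bijective h h' h₀ h₁ H)
    refine ⟨(Ext.homAddEquiv Y X).symm.trans (f.trans Abelian.Ext.addEquiv₀.symm), fun x y => ?_⟩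
    obtain ⟨g, rfl⟩ := (Ext.homAddEquiv Y X).surjective x
    rw [AddEquiv.trans_apply, AddEquiv.symm_apply_apply]
    exact eq_comm.trans (mapRel_zero_iff (phi M) g y).symm
  | succ i ih =>
    obtain _ | k := k
    · lia
    obtain ⟨M₀, Z, a, p, h₀, h, H, hZ⟩ := hY
    obtain ⟨e, he⟩ := ih k (by lia) Z hZ (rightExtOrthogonal.mono (by lia) hX)
    have hS := (shortExact_phi_iff h).2 H
    have := projective_phi_obj h₀
    have hP : ∀ (y : Abelian.Ext.{max u (v + 1)} ((phi M).obj M₀) ((phi M).obj X) (i + 1)),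
        y = 0 := fun y => y.eq_zero_of_projective
    have hpull : ∀ m : 𝓔.Ext i M₀ X, ∃ m', e (Ext.pull a m) =
        (Abelian.Ext.mk₀ ((phi M).map a)).comp m' (zero_add i) := by
      intro m
      cases i with
      | zero =>
        obtain ⟨g, rfl⟩ := Ext.exists_mk_hom m
        exact ⟨_, (he _ _).2 (MapRel.pull ((mapRel_zero_iff _ g _).2 rfl) a)⟩
      | succ i =>
        exact ⟨0, by rw [hX _ (by lia) (by lia) M₀ h₀ m, Ext.pull_zero, map_zero,
          Abelian.Ext.comp_zero]⟩
    have hpull' : ∀ m' : Abelian.Ext.{max u (v + 1)} ((phi M).obj M₀) ((phi M).obj X) i,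
        ∃ m : 𝓔.Ext i M₀ X, e (Ext.pull a m) =
          (Abelian.Ext.mk₀ ((phi M).map a)).comp m' (zero_add i) := by
      intro m'
      cases i with
      | zero =>
        obtain ⟨β, rfl⟩ := (Abelian.Ext.mk₀_bijective _ _).2 m'
        obtain ⟨g, rfl⟩ := phi_map_surjective_of_prop h₀ β
        exact ⟨_, (he _ _).2 (MapRel.pull ((mapRel_zero_iff _ g _).2 rfl) a)⟩
      | succ i =>
        exact ⟨0, by rw [Abelian.Ext.eq_zero_of_projective m', Ext.pull_zero, map_zero,
          Abelian.Ext.comp_zero]⟩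
    have hker : ∀ x, Ext.spliceRightHom h X i x = 0 ↔ (mapExtClass (phi M) h hS).precomp
        ((phi M).obj X) (add_comm 1 i) (e x) = 0 := by
      refine fun x => ⟨fun hx => ?_, fun hx => ?_⟩
      · obtain ⟨m, rfl⟩ := (Ext.contravariant_exact i).1 h x hx
        obtain ⟨m', hm'⟩ := hpull m
        rw [hm']
        exact hS.extClass_comp_assoc (h := add_comm 1 i) m'
      · obtain ⟨m', hm'⟩ := Abelian.Ext.contravariant_sequence_exact₁ hS _ (e x)
          (add_comm 1 i) hx
        obtain ⟨m, hm⟩ := hpull' m'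
        rw [e.injective (hm'.symm.trans hm.symm)]
        exact Ext.spliceRight_pull_self h m
    obtain ⟨e', he'⟩ := AddEquiv.exists_of_surjective (Ext.spliceRightHom h X i)
      (fun x => (Ext.contravariant_exact i).2 h x (hX _ (by lia) hi M₀ h₀ _))
      ((mapExtClass (phi M) h hS).precomp ((phi M).obj X) (add_comm 1 i))
      (fun y => Abelian.Ext.contravariant_sequence_exact₃ hS _ y (hP _) (add_comm 1 i)) e hker
    refine ⟨e', fun x y => ⟨?_, fun hxy => ?_⟩⟩
    · rintro rfl
      obtain ⟨x, rfl⟩ := (Ext.contravariant_exact i).2 h x (hX _ (by lia) hi M₀ h₀ _)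
      exact (he' x).symm ▸ MapRel.spliceRight h hS ((he _ _).1 rfl)
    · obtain ⟨x', y', hxy', rfl, rfl⟩ := MapRel.exists_spliceRight h hS h₀ hxy
      rw [← (he _ _).2 hxy']
      exact he' x'

end ExactStructure
end

theorem mainTheorem6 {C : Type u} [Category.{v} C] [Preadditive C] [HasZeroObject C]
    [HasBinaryBiproducts C] (𝓔 : ExactStructure C) (M : ObjectProperty C)
    [HasZeroObject M.FullSubcategory] [HasBinaryBiproducts M.FullSubcategory]
    (k : ℕ) (hk : 1 ≤ k) :
    (∃ φ : ∀ (i : ℕ) (_ : i < k) (X Y : C) (_ : 𝓔.cogen M k X) (_ : 𝓔.leftExtOrthogonal M k Y),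
        𝓔.Ext i Y X ≃+ Abelian.Ext.{max u (v + 1)}
          ((psi M).obj (Opposite.op X)) ((psi M).obj (Opposite.op Y)) i,
      -- `φ` is induced by `Ψ`: every class is represented by an extension whose image under `Ψ`
      -- is exact, and it is sent to the class of the image of any such extension
      (∀ (i : ℕ) (hi : i < k) (X Y : C) (hX : 𝓔.cogen M k X) (hY : 𝓔.leftExtOrthogonal M k Y)
        (x : 𝓔.Ext i Y X)
        (y : Abelian.Ext.{max u (v + 1)}
          ((psi M).obj (Opposite.op X)) ((psi M).obj (Opposite.op Y)) i),
        φ i hi X Y hX hY x = y ↔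
          ∃ (ξ : 𝓔.YonedaExtension X i Y) (hξ : ξ.OpMapExact (psi M)),
            ExactStructure.Ext.mk ξ = x ∧ ξ.opMapClass (psi M) hξ = y) ∧
      -- `φ` is natural in `X`
      (∀ (i : ℕ) (hi : i < k) (X X' Y : C) (hX : 𝓔.cogen M k X) (hX' : 𝓔.cogen M k X')
        (hY : 𝓔.leftExtOrthogonal M k Y) (f : X ⟶ X') (x : 𝓔.Ext i Y X),
        φ i hi X' Y hX' hY (ExactStructure.Ext.push f x) =
          (Abelian.Ext.mk₀ ((psi M).map f.op)).comp (φ i hi X Y hX hY x) (zero_add i)) ∧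
      -- `φ` is natural in `Y`
      (∀ (i : ℕ) (hi : i < k) (X Y Y' : C) (hX : 𝓔.cogen M k X)
        (hY : 𝓔.leftExtOrthogonal M k Y) (hY' : 𝓔.leftExtOrthogonal M k Y')
        (g : Y' ⟶ Y) (x : 𝓔.Ext i Y X),
        φ i hi X Y' hX hY' (ExactStructure.Ext.pull g x) =
          (φ i hi X Y hX hY x).comp (Abelian.Ext.mk₀ ((psi M).map g.op)) (add_zero i))) ∧
    (∃ φ : ∀ (i : ℕ) (_ : i < k) (X Y : C) (_ : 𝓔.rightExtOrthogonal M k X) (_ : 𝓔.gen M k Y),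
        𝓔.Ext i Y X ≃+ Abelian.Ext.{max u (v + 1)} ((phi M).obj Y) ((phi M).obj X) i,
      -- `φ` is induced by `Φ`
      (∀ (i : ℕ) (hi : i < k) (X Y : C) (hX : 𝓔.rightExtOrthogonal M k X) (hY : 𝓔.gen M k Y)
        (x : 𝓔.Ext i Y X)
        (y : Abelian.Ext.{max u (v + 1)} ((phi M).obj Y) ((phi M).obj X) i),
        φ i hi X Y hX hY x = y ↔
          ∃ (ξ : 𝓔.YonedaExtension X i Y) (hξ : ξ.MapExact (phi M)),
            ExactStructure.Ext.mk ξ = x ∧ ξ.mapClass (phi M) hξ = y) ∧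
      -- `φ` is natural in `X`
      (∀ (i : ℕ) (hi : i < k) (X X' Y : C) (hX : 𝓔.rightExtOrthogonal M k X)
        (hX' : 𝓔.rightExtOrthogonal M k X') (hY : 𝓔.gen M k Y) (f : X ⟶ X') (x : 𝓔.Ext i Y X),
        φ i hi X' Y hX' hY (ExactStructure.Ext.push f x) =
          (φ i hi X Y hX hY x).comp (Abelian.Ext.mk₀ ((phi M).map f)) (add_zero i)) ∧
      -- `φ` is natural in `Y`
      (∀ (i : ℕ) (hi : i < k) (X Y Y' : C) (hX : 𝓔.rightExtOrthogonal M k X)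
        (hY : 𝓔.gen M k Y) (hY' : 𝓔.gen M k Y') (g : Y' ⟶ Y) (x : 𝓔.Ext i Y X),
        φ i hi X Y' hX hY' (ExactStructure.Ext.pull g x) =
          (Abelian.Ext.mk₀ ((phi M).map g)).comp (φ i hi X Y hX hY x) (zero_add i))) := by
  constructor
  · choose φ hφ using fun (i : ℕ) (hi : i < k) (X Y : C) (hX : 𝓔.cogen M k X)
      (hY : 𝓔.leftExtOrthogonal M k Y) => ExactStructure.exists_addEquiv_psi i k hi X Y
        (ExactStructure.hasCoresolution_of_cogen hX) hY
    exact ⟨φ, hφ,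
      -- The pushed class is related to the composite of the image class with Ψ f, and the relation
      -- determines the value of φ.
      fun i hi X X' Y hX hX' hY f x => (hφ i hi X' Y hX' hY _ _).2
        (((hφ i hi X Y hX hY x _).1 rfl).push f),
      fun i hi X Y Y' hX hY hY' g x => (hφ i hi X Y' hX hY' _ _).2
        (((hφ i hi X Y hX hY x _).1 rfl).pull g)⟩
  · choose φ hφ using fun (i : ℕ) (hi : i < k) (X Y : C) (hX : 𝓔.rightExtOrthogonal M k X)
      (hY : 𝓔.gen M k Y) => ExactStructure.exists_addEquiv_phi i k hi X Y
        (ExactStructure.hasResolution_of_gen hY) hX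
    exact ⟨φ, hφ,
      fun i hi X X' Y hX hX' hY f x => (hφ i hi X' Y hX' hY _ _).2
        (((hφ i hi X Y hX hY x _).1 rfl).push f),
      fun i hi X Y Y' hX hY hY' g x => (hφ i hi X Y' hX hY' _ _).2
        (((hφ i hi X Y hX hY x _).1 rfl).pull g)⟩
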